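/- Let $[n]=\{1,\dots,n\}$, and for distributions $\mu,\chi$ over $[n]$ let $d(\mu,\chi)=\sum_{i\in[n]}|\mu(i)-\chi(i)|$. A property of distributions $\mathcal C$ specifies, for every $n\in\mathbb N$, a set $\mathcal C_n$ of probability distributions over $[n]$; a distribution $\mu$ over $[n]$ is $\epsilon$-far from $\mathcal C$ if $d(\mu,\chi)>\epsilon$ for all $\chi\in\mathcal C_n$. An atlas over $[n]$ of length $\ell$ is a pair $(\mathcal I,\mathcal M)$, where $\mathcal I=(I_1,\dots,I_\ell)$ is a partition of $[n]$ into intervals and $\mathcal M=(M_1,\dots,M_\ell)$ is a sequence of multisets of nonnegative reals with $|M_j|=|I_j|$ such that all members of all the $M_j$ sum to $1$. A distribution $\mu$ over $[n]$ conforms to $(\mathcal I,\mathcal M)$ if for every $j$ the multiset of the values $\mu(i)$, $i\in I_j$, is $M_j$. For a function $k:\mathbb R^+\times\mathbb N\to\mathbb N$, the property $\mathcal C$ is $k$-characterized by atlases if for every $n\in\mathbb N$ and every $\epsilon>0$ there is a set $\mathbb A$ of atlases over $[n]$ of lengths at most $k(\epsilon,n)$ such that every $\mu\in\mathcal C_n$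 conforms to some $\mathcal A\in\mathbb A$, while no distribution over $[n]$ that conforms to some $\mathcal A\in\mathbb A$ is $\epsilon$-far from $\mathcal C$. A conditional oracle of a distribution $\mu$ over $[n]$ takes a nonempty set $A\subseteq[n]$ and returns, independently of its earlier answers, a point $i\in A$ with probability $\mu(i)/\sum_{j\in A}\mu(j)$, or a uniformly random point of $A$ if $\mu(A)=0$. An adaptive conditional algorithm with $q$ queries is a randomized algorithm that makes at most $q$ calls to the oracle, each on a set that may depend on the previous answers and the internal coin tosses, and then accepts or rejects. Theorem. There is a polynomial $P$ in two variables such that the following holds. Let $k:\mathbb R^+\times\mathbb N\to\mathbb N$ and let $\mathcal C$ be a property of distributions that is $k$-characterized by atlases. Then for every $\epsilon>0$ and every $n\in\mathbb N$ there is an adaptive conditional algorithm making at most $k(\epsilon/5,n)\cdot P(\log n,1/\epsilon)$ queries that accepts with probability at least $2/3$ if the input distribution over $[n]$ is in $\mathcal C$, and rejects with probability at least $2/3$ if it is $\epsilon$-far from $\mathcal C$. (For $n=0$ there are no distributions over $[n]$, and $\log 0$ is read as $0$.) -/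

import Mathlib

open scoped ENNReal

noncomputable section

namespace AtlasTesting

/-- A property of distributions: for every `n`, a set of probability distributions over the
`n`-point domain `[n]`, which is represented by `Fin n`. -/
abbrev DistProperty : Type := (n : ℕ) → Set (PMF (Fin n))

/-- The `ℓ₁` distance `∑ i, |μ i - χ i|` between two distributions over `[n]`. -/
def l1dist {n : ℕ} (μ χ : PMF (Fin n)) : ℝ :=
  ∑ i : Fin n, |(μ i).toReal - (χ i).toReal|

/-- `μ` is `ε`-far from a set `C` of distributions over `[n]`. -/
def IsFar {n : ℕ} (ε : ℝ) (μ : PMF (Fin n)) (C : Set (PMF (Fin n))) : Prop :=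
  ∀ χ ∈ C, ε < l1dist μ χ

/-! ### Interval partitions, inventories and atlases -/

/-- A partition `(I_1, …, I_len)` of `[n]` into nonempty intervals, listed from left to right. -/
structure IntervalPartition (n : ℕ) where
  len : ℕ
  part : Fin len → Finset (Fin n)
  isInterval : ∀ j, ∃ a b : Fin n, a ≤ b ∧ part j = Finset.Icc a b
  ordered : ∀ j j', j < j' → ∀ a ∈ part j, ∀ b ∈ part j', a < b
  cover : ∀ i, ∃ j, i ∈ part j

/-- The inventory of `μ` over `I`: the multiset of the values `μ i`, `i ∈ I`. -/
def inventory {n : ℕ} (μ : PMF (Fin n)) (I : Finset (Fin n)) : Multiset ℝ≥0∞ :=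
  I.val.map μ

/-- An atlas over `[n]`: an interval partition together with, for every interval, a multiset with
as many (nonnegative) members as the interval has points, all members of all multisets summing
to `1`. -/
structure Atlas (n : ℕ) where
  partition : IntervalPartition n
  inv : Fin partition.len → Multiset ℝ≥0∞
  card_inv : ∀ j, (inv j).card = (partition.part j).card
  sum_inv : ∑ j, (inv j).sum = 1

/-- The length of an atlas. -/
def Atlas.length {n : ℕ} (𝒜 : Atlas n) : ℕ := 𝒜.partition.len

/-- `μ` conforms to `𝒜` if `𝒜` is the atlas of `μ` over the interval partition of `𝒜`. -/
def Conforms {n : ℕ} (μ : PMF (Fin n)) (𝒜 : Atlas n) : Prop :=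
  ∀ j, inventory μ (𝒜.partition.part j) = 𝒜.inv j

/-- The property `C` is `k`-characterized by atlases (`k` matters only for positive `ε`). -/
def IsCharacterizedByAtlases (k : ℝ → ℕ → ℕ) (C : DistProperty) : Prop :=
  ∀ (n : ℕ) (ε : ℝ), 0 < ε →
    ∃ 𝔸 : Set (Atlas n),
      (∀ 𝒜 ∈ 𝔸, 𝒜.length ≤ k ε n) ∧
      (∀ μ ∈ C n, ∃ 𝒜 ∈ 𝔸, Conforms μ 𝒜) ∧
      (∀ 𝒜 ∈ 𝔸, ∀ μ : PMF (Fin n), Conforms μ 𝒜 → ¬ IsFar ε μ (C n))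

/-! ### Conditional oracles and adaptive algorithms -/

open Classical in
/-- The answer of the conditional oracle of `μ` on a nonempty set `A`: the point `i ∈ A` with
probability `μ i / ∑ j ∈ A, μ j` if `A` has positive weight, and a uniform point of `A`
otherwise. -/
def condOracle {n : ℕ} (μ : PMF (Fin n)) (A : Finset (Fin n)) (hA : A.Nonempty) : PMF (Fin n) :=
  if h : ∃ i ∈ (A : Set (Fin n)), i ∈ μ.support then μ.filter (A : Set (Fin n)) h
  else PMF.uniformOfFinset A hA

/-- Randomized adaptive algorithms with output in `α` that have access to a conditional oracle of
an unknown distribution over `[n]` and make at most `q` queries on every computation path. Such an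
algorithm either stops with an output, or makes an internal random choice and continues depending
on its result, or queries the oracle on a nonempty set `A ⊆ [n]` and continues depending on the
answer. Hence every queried set is a function of the previous answers and the internal
randomness. -/
inductive CondAlgorithm (n : ℕ) (α : Type) : ℕ → Type
  | done {q : ℕ} (output : α) : CondAlgorithm n α q
  | toss {q : ℕ} (law : PMF ℕ) (next : ℕ → CondAlgorithm n α q) : CondAlgorithm n α q
  | query {q : ℕ} (A : Finset (Fin n)) (hA : A.Nonempty)
      (next : Fin n → CondAlgorithm n α q) : CondAlgorithm n α (q + 1)

/-- The distribution of the output when the algorithm is run with the conditional oracle of `μ`.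
Every random choice and every oracle answer is drawn afresh. -/
def CondAlgorithm.run {n : ℕ} {α : Type} (μ : PMF (Fin n)) :
    {q : ℕ} → CondAlgorithm n α q → PMF α
  | _, .done a => PMF.pure a
  | _, .toss law next => law.bind fun r => (next r).run μ
  | _, .query A hA next => (condOracle μ A hA).bind fun j => (next j).run μ

/-- `T` (output `true` means accept) is an adaptive conditional tester for the set `C` of
distributions over `[n]` with accuracy `ε` and error probability `δ`. -/
def IsConditionalTester {n q : ℕ} (C : Set (PMF (Fin n))) (ε δ : ℝ)
    (T : CondAlgorithm n Bool q) : Prop :=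
  (∀ μ ∈ C, 1 - δ ≤ ((T.run μ) true).toReal) ∧
  (∀ μ : PMF (Fin n), IsFar ε μ C → 1 - δ ≤ ((T.run μ) false).toReal)

end AtlasTesting

end

noncomputable section

namespace AtlasTesting

open MeasureTheory

/-! The tester draws `t` plain samples `xs` and `s` weighted samples, that is, points of `μ` paired
with estimates of their weights. It accepts iff some `χ ∈ C` exists for which this outcome is
`Representative`. Completeness asks that the outcome be representative of `μ` itself with
probability at least 2/3. Soundness asks that an outcome representative of both `μ` and a `χ ∈ C`
force `μ` to be close to `C`.

The points `xs` cut `[n]` into classes (`fineLabel`), and within a class only the multiset of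
weights matters. That multiset is encoded by the sum of the indicators of `(0, μ i]`. The `L¹`
distance of two such sums is the cost of the best matching of the two multisets
(`exists_perm_sum_abs_sub_eq`). The family of these sums over all classes is `profile`. It is also
the mean, over `y` drawn from `μ`, of the normalised indicator of `(0, μ y]` placed at the class of
`y`, so averaging weighted samples estimates it.

Soundness (`exists_conforming_l1dist_le`): close profiles give a permutation of `χ` within classes
that is close to `μ`. A class inside one interval of the atlas of `χ` may be permuted without losing
conformity. Classes that cross a boundary are left alone; they have at least two points, so each is
light, and at most one is charged to each interval (`Covers.mass_crossing_le`). The rearranged `χ`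
still conforms to the atlas, hence is near `C`.

Completeness (`prob_not_representative_le`): a weight is estimated by multiplying conditional
frequencies along the dyadic blocks that shrink to the point (`weightedSample`). Descents into
relatively light blocks are unlikely (`prob_light_block_le`). Averages of general `L¹` vectors have
no variance bound, so the vectors are first rounded to finitely many, one for each class and each
geometric scale of weight. Then the variances of the cell counts suffice
(`expect_enorm_average_sub_le`). -/

/-- The family of output laws `p μ` is produced by a conditional algorithm with `q` queries. -/
def Implementable {n : ℕ} {α : Type} (q : ℕ) (p : PMF (Fin n) → PMF α) : Prop :=
  ∃ T : CondAlgorithm n α q, ∀ μ, T.run μ = p μ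

/-! ### Composition of conditional algorithms and addition of query budgets. -/

namespace Implementable

variable {n q r : ℕ} {α β : Type}

theorem pure (a : α) : Implementable (n := n) q fun _ => PMF.pure a :=
  ⟨.done a, fun _ => by simp only [CondAlgorithm.run]⟩

theorem toss (law : PMF ℕ) {p : ℕ → PMF (Fin n) → PMF α} (h : ∀ j, Implementable q (p j)) :
    Implementable q fun μ => law.bind fun j => p j μ := by
  choose T hT using h
  exact ⟨.toss law T, fun μ => by simp only [CondAlgorithm.run, hT]⟩

theorem query {A : Finset (Fin n)} (hA : A.Nonempty) {p : Fin n → PMF (Fin n) → PMF α}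
    (h : ∀ j, Implementable q (p j)) :
    Implementable (q + 1) fun μ => (condOracle μ A hA).bind fun j => p j μ := by
  choose T hT using h
  exact ⟨.query A hA T, fun μ => by simp only [CondAlgorithm.run, hT]⟩

/-- The budget is an index of the type and `done` exists at every budget, so a tree can be rebuilt
with a larger one. This lets branches of different cost be joined. -/
theorem run_mono (T : CondAlgorithm n α q) : ∀ r, q ≤ r → Implementable r fun μ => T.run μ := by
  induction T with
  | done a => intro r _; simpa only [CondAlgorithm.run] using pure a
  | toss law next ih =>
    intro r hr
    simpa only [CondAlgorithm.run] using toss law fun j => ih j r hr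
  | query A hA next ih =>
    intro r hr
    obtain ⟨r, rfl⟩ : ∃ r', r = r' + 1 := ⟨r - 1, by omega⟩
    simpa only [CondAlgorithm.run] using query hA fun j => ih j r (by omega)

theorem mono {p : PMF (Fin n) → PMF α} (h : Implementable q p) (hqr : q ≤ r) :
    Implementable r p := by
  obtain ⟨T, hT⟩ := h
  obtain rfl : (fun μ => T.run μ) = p := funext hT
  exact run_mono T r hqr

theorem run_bind (T : CondAlgorithm n α q) {p : α → PMF (Fin n) → PMF β}
    (h : ∀ a, Implementable r (p a)) :
    Implementable (q + r) fun μ => (T.run μ).bind fun a => p a μ := by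
  induction T with
  | done a => simpa only [CondAlgorithm.run, PMF.pure_bind] using (h a).mono (by omega)
  | toss law next ih =>
    simpa only [CondAlgorithm.run, PMF.bind_bind] using toss law ih
  | @query q A hA next ih =>
    rw [Nat.add_right_comm]
    simpa only [CondAlgorithm.run, PMF.bind_bind] using query hA ih

theorem bind {p : PMF (Fin n) → PMF α} {g : α → PMF (Fin n) → PMF β} (hp : Implementable q p)
    (hg : ∀ a, Implementable r (g a)) :
    Implementable (q + r) fun μ => (p μ).bind fun a => g a μ := by
  obtain ⟨T, hT⟩ := hp
  obtain rfl : (fun μ => T.run μ) = p := funext hT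
  exact run_bind T hg

theorem map {p : PMF (Fin n) → PMF α} (hp : Implementable q p) (f : α → β) :
    Implementable q fun μ => (p μ).map f :=
  hp.bind (r := 0) fun a => pure (f a)

theorem oracle {A : Finset (Fin n)} (hA : A.Nonempty) :
    Implementable 1 fun μ => condOracle μ A hA := by
  simpa only [PMF.bind_pure] using query (q := 0) hA fun j => pure j

end Implementable

/-! ### Expectations under discrete distributions -/

section Expect

variable {α β : Type}

/-- The expectation of an `ℝ≥0∞`-valued function. -/
def expect (p : PMF α) (f : α → ℝ≥0∞) : ℝ≥0∞ := ∑' a, p a * f a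

/-- The probability of an event. -/
def prob (p : PMF α) (S : Set α) : ℝ≥0∞ := expect p (S.indicator 1)

theorem expect_pure (a : α) (f : α → ℝ≥0∞) : expect (PMF.pure a) f = f a := by
  classical
  simp [expect, PMF.pure_apply, ite_mul]

theorem expect_bind (p : PMF α) (g : α → PMF β) (f : β → ℝ≥0∞) :
    expect (p.bind g) f = expect p fun a => expect (g a) f := by
  simp only [expect, PMF.bind_apply, ← ENNReal.tsum_mul_right, ← ENNReal.tsum_mul_left]
  rw [ENNReal.tsum_comm]
  simp only [mul_assoc]

theorem expect_map (p : PMF α) (g : α → β) (f : β → ℝ≥0∞) :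
    expect (p.map g) f = expect p (f ∘ g) := by
  rw [PMF.map, expect_bind]
  simp only [Function.comp_apply, expect_pure]
  rfl

theorem expect_add (p : PMF α) (f g : α → ℝ≥0∞) :
    expect p (fun a => f a + g a) = expect p f + expect p g := by
  simp only [expect, mul_add, ENNReal.tsum_add]

theorem expect_const (p : PMF α) (c : ℝ≥0∞) : expect p (fun _ => c) = c := by
  simp only [expect, ENNReal.tsum_mul_right, p.tsum_coe, one_mul]

theorem expect_const_mul (p : PMF α) (c : ℝ≥0∞) (f : α → ℝ≥0∞) :
    expect p (fun a => c * f a) = c * expect p f := by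
  simp only [expect, ← ENNReal.tsum_mul_left, mul_left_comm]

theorem expect_mono_support {p : PMF α} {f g : α → ℝ≥0∞} (h : ∀ a, p a ≠ 0 → f a ≤ g a) :
    expect p f ≤ expect p g := by
  refine ENNReal.tsum_le_tsum fun a => ?_
  by_cases ha : p a = 0
  · simp [ha]
  · exact mul_le_mul_right (h a ha) _

theorem expect_mono {p : PMF α} {f g : α → ℝ≥0∞} (h : ∀ a, f a ≤ g a) :
    expect p f ≤ expect p g :=
  expect_mono_support fun a _ => h a

theorem expect_le_of_support {p : PMF α} {f : α → ℝ≥0∞} {c : ℝ≥0∞}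
    (h : ∀ a, p a ≠ 0 → f a ≤ c) : expect p f ≤ c :=
  (expect_mono_support h).trans (expect_const p c).le

theorem expect_finset_sum {ι : Type*} (p : PMF α) (s : Finset ι) (f : ι → α → ℝ≥0∞) :
    expect p (fun a => ∑ i ∈ s, f i a) = ∑ i ∈ s, expect p (f i) := by
  classical
  induction s using Finset.induction_on with
  | empty => simp [expect]
  | insert i s hi ih => simp only [Finset.sum_insert hi, expect_add, ih]

theorem expect_fintype [Fintype α] (p : PMF α) (f : α → ℝ≥0∞) :
    expect p f = ∑ a, p a * f a := tsum_fintype _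

theorem prob_le_one (p : PMF α) (S : Set α) : prob p S ≤ 1 :=
  expect_le_of_support fun a _ => Set.indicator_le_self' (by simp) a

theorem prob_mono {p : PMF α} {S T : Set α} (h : S ⊆ T) : prob p S ≤ prob p T :=
  expect_mono fun a => Set.indicator_le_indicator_of_subset h (by simp) a

theorem prob_add_compl (p : PMF α) (S : Set α) : prob p S + prob p Sᶜ = 1 := by
  rw [prob, prob, ← expect_add, ← expect_const p 1]
  congr 1
  ext a
  by_cases h : a ∈ S <;> simp [h]

theorem prob_compl (p : PMF α) (S : Set α) : prob p Sᶜ = 1 - prob p S :=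
  ENNReal.eq_sub_of_add_eq (ne_top_of_le_ne_top ENNReal.one_ne_top (prob_le_one p S))
    ((add_comm _ _).trans (prob_add_compl p S))

theorem prob_iUnion_le {ι : Type*} [Fintype ι] (p : PMF α) (S : ι → Set α) :
    prob p (⋃ i, S i) ≤ ∑ i, prob p (S i) := by
  simp only [prob]
  rw [← expect_finset_sum]
  refine expect_mono fun a => ?_
  by_cases h : a ∈ ⋃ i, S i
  · obtain ⟨i, hi⟩ := Set.mem_iUnion.1 h
    rw [Set.indicator_of_mem h]
    exact (by simp [hi] : (1 : ℝ≥0∞) ≤ (S i).indicator 1 a).trans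
      (Finset.single_le_sum (f := fun i => (S i).indicator (1 : α → ℝ≥0∞) a)
        (fun _ _ => zero_le) (Finset.mem_univ i))
  · simp [h]

theorem prob_bind (p : PMF α) (g : α → PMF β) (S : Set β) :
    prob (p.bind g) S = expect p fun a => prob (g a) S := expect_bind _ _ _

theorem prob_map (p : PMF α) (g : α → β) (S : Set β) :
    prob (p.map g) S = prob p (g ⁻¹' S) := by
  rw [prob, expect_map]; rfl

theorem prob_singleton (p : PMF α) (a : α) : prob p {a} = p a := by
  classical
  rw [prob, expect, tsum_eq_single a] <;> simp +contextual

theorem prob_bind_le {p : PMF α} {g : α → PMF β} {S : Set β} {T : Set α} {c : ℝ≥0∞}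
    (h : ∀ a, p a ≠ 0 → a ∉ T → prob (g a) S ≤ c) : prob (p.bind g) S ≤ prob p T + c := by
  rw [prob_bind, ← expect_const p c, prob, ← expect_add]
  refine expect_mono_support fun a hp => ?_
  by_cases ha : a ∈ T
  · simpa [ha] using (prob_le_one _ _).trans le_self_add
  · simpa [ha] using h a hp ha

theorem expect_le_mul_add {p : PMF α} {f : α → ℝ≥0∞} {S : Set α} {b c : ℝ≥0∞}
    (hS : ∀ a, f a ≤ b) (h : ∀ a, p a ≠ 0 → a ∉ S → f a ≤ c) :
    expect p f ≤ b * prob p S + c := by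
  rw [← expect_const p c, prob, ← expect_const_mul, ← expect_add]
  refine expect_mono_support fun a hp => ?_
  by_cases ha : a ∈ S
  · simpa [ha] using (hS a).trans le_self_add
  · simpa [ha] using h a hp ha

theorem mul_prob_le_expect (p : PMF α) (f : α → ℝ≥0∞) (c : ℝ≥0∞) :
    c * prob p {a | c ≤ f a} ≤ expect p f := by
  rw [prob, ← expect_const_mul]
  refine expect_mono fun a => ?_
  by_cases h : c ≤ f a <;> simp [h]

open Classical in
theorem expect_ite (p : PMF α) (S : Set α) (x y : ℝ≥0∞) :
    expect p (fun a => if a ∈ S then x else y) = x * prob p S + y * prob p Sᶜ := by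
  rw [prob, prob, ← expect_const_mul, ← expect_const_mul, ← expect_add]
  congr 1
  ext a
  by_cases h : a ∈ S <;> simp [h]

/-! ### Independent repetition -/

/-- The law of a list of `s` independent draws from `p`. -/
def iid (p : PMF α) : ℕ → PMF (List α)
  | 0 => PMF.pure []
  | s + 1 => p.bind fun a => (iid p s).map (a :: ·)

theorem expect_iid_succ (p : PMF α) (s : ℕ) (f : List α → ℝ≥0∞) :
    expect (iid p (s + 1)) f = expect p fun a => expect (iid p s) fun l => f (a :: l) := by
  rw [iid, expect_bind]
  simp only [expect_map]
  rfl

theorem expect_iid_sum (p : PMF α) (f : α → ℝ≥0∞) (s : ℕ) :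
    expect (iid p s) (fun l => (l.map f).sum) = s * expect p f := by
  induction s with
  | zero => simp [iid, expect_pure]
  | succ s ih =>
    rw [expect_iid_succ]
    simp only [List.map_cons, List.sum_cons, expect_add, expect_const, ih]
    push_cast
    ring

theorem prob_iid_forall_notMem (p : PMF α) (S : Set α) (s : ℕ) :
    prob (iid p s) {l | ∀ x ∈ l, x ∉ S} = (1 - prob p S) ^ s := by
  induction s with
  | zero => simp [iid, prob, expect_pure]
  | succ s ih =>
    have key : ∀ a, (expect (iid p s) fun l =>
        ({l | ∀ x ∈ l, x ∉ S} : Set (List α)).indicator 1 (a :: l)) =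
        (1 - prob p S) ^ s * Sᶜ.indicator 1 a := by
      intro a
      by_cases ha : a ∈ S
      · simp [ha, Set.indicator, expect]
      · rw [← ih, prob]
        simp only [Set.indicator_of_mem (show a ∈ Sᶜ from ha), Pi.one_apply, mul_one]
        congr 1
        ext l
        have : a :: l ∈ {l | ∀ x ∈ l, x ∉ S} ↔ l ∈ {l | ∀ x ∈ l, x ∉ S} := by
          simp only [Set.mem_ofPred_eq, List.forall_mem_cons, ha, not_false_eq_true, true_and]
        by_cases h : l ∈ {l | ∀ x ∈ l, x ∉ S}
        · rw [Set.indicator_of_mem h, Set.indicator_of_mem (this.2 h)]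
          rfl
        · rw [Set.indicator_of_notMem h, Set.indicator_of_notMem (mt this.1 h)]
    rw [prob, expect_iid_succ]
    simp only [key, expect_const_mul]
    rw [← prob, prob_compl, pow_succ]

open Classical in
/-- The number of entries of a list that lie in `S`. -/
def hits (S : Set α) (l : List α) : ℝ := (l.map fun a => if a ∈ S then (1 : ℝ) else 0).sum

open Classical in
theorem hits_cons (S : Set α) (a : α) (l : List α) :
    hits S (a :: l) = (if a ∈ S then 1 else 0) + hits S l := by simp [hits]

theorem hits_nonneg (S : Set α) (l : List α) : 0 ≤ hits S l := by
  classical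
  refine List.sum_nonneg fun x hx => ?_
  obtain ⟨a, -, rfl⟩ := List.mem_map.1 hx
  split_ifs <;> simp

/-- The free shift `c` makes the induction work: conditioning on the first draw replaces `c` by `c +
1 - P` or `c - P`, and averaging the squares adds one variance `P * (1 - P)`. -/
theorem expect_sq_hits_aux (p : PMF α) (S : Set α) {P : ℝ} (hP : ENNReal.ofReal P = prob p S)
    (h0 : 0 ≤ P) (s : ℕ) : ∀ c : ℝ,
    expect (iid p s) (fun l => ENNReal.ofReal ((c + hits S l - s * P) ^ 2)) =
      ENNReal.ofReal (c ^ 2 + s * (P * (1 - P))) := by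
  classical
  have h1 : P ≤ 1 := by
    have := prob_le_one p S
    rwa [← hP, ENNReal.ofReal_le_one] at this
  have hc : prob p Sᶜ = ENNReal.ofReal (1 - P) := by
    rw [prob_compl, ← hP, ENNReal.ofReal_sub _ h0, ENNReal.ofReal_one]
  induction s with
  | zero => intro c; simp [iid, expect_pure, hits]
  | succ s ih =>
    intro c
    rw [expect_iid_succ]
    have : ∀ a, expect (iid p s) (fun l =>
        ENNReal.ofReal ((c + hits S (a :: l) - (s + 1 : ℕ) * P) ^ 2)) =
        if a ∈ S then ENNReal.ofReal ((c + 1 - P) ^ 2 + s * (P * (1 - P)))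
        else ENNReal.ofReal ((c - P) ^ 2 + s * (P * (1 - P))) := by
      intro a
      split_ifs with ha
      · rw [← ih]
        congr 1; ext l; rw [hits_cons, if_pos ha]; congr 2; push_cast; ring
      · rw [← ih]
        congr 1; ext l; rw [hits_cons, if_neg ha]; congr 2; push_cast; ring
    have hq : 0 ≤ P * (1 - P) := mul_nonneg h0 (by linarith)
    simp only [this]
    rw [expect_ite, hc, ← hP, ← ENNReal.ofReal_mul (by positivity),
      ← ENNReal.ofReal_mul (by positivity), ← ENNReal.ofReal_add]
    · congr 1; push_cast; ring
    · positivity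
    · exact mul_nonneg (by positivity) (by linarith)

theorem expect_sq_hits_le (p : PMF α) (S : Set α) {P : ℝ} (hP : ENNReal.ofReal P = prob p S)
    (h0 : 0 ≤ P) (s : ℕ) :
    expect (iid p s) (fun l => ENNReal.ofReal ((hits S l - s * P) ^ 2)) ≤
      ENNReal.ofReal (s * P) := by
  have := expect_sq_hits_aux p S hP h0 s 0
  simp only [zero_add] at this
  rw [this]
  apply ENNReal.ofReal_le_ofReal
  nlinarith [mul_nonneg (Nat.cast_nonneg (α := ℝ) s) (mul_nonneg h0 h0)]

/-- Chebyshev's inequality for the multiplicative error of an empirical frequency. -/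
theorem prob_hits_far_le (p : PMF α) (S : Set α) {P γ : ℝ} (hP : ENNReal.ofReal P = prob p S)
    (h0 : 0 < P) (hγ : 0 < γ) {s : ℕ} (hs : 0 < s) :
    prob (iid p s) {l | ¬ |hits S l / s - P| ≤ γ * P} ≤ ENNReal.ofReal (1 / (s * P * γ ^ 2)) := by
  have hs' : (0 : ℝ) < s := by exact_mod_cast hs
  set c : ℝ := (γ * P * s) ^ 2
  have hc : 0 < c := by positivity
  have h := (mul_prob_le_expect (iid p s) (fun l => ENNReal.ofReal ((hits S l - s * P) ^ 2))
    (ENNReal.ofReal c)).trans (expect_sq_hits_le p S hP h0.le s)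
  have hsub : {l : List α | ¬ |hits S l / s - P| ≤ γ * P} ⊆
      {l | ENNReal.ofReal c ≤ ENNReal.ofReal ((hits S l - s * P) ^ 2)} := by
    intro l hl
    simp only [Set.mem_ofPred_eq, not_le] at hl ⊢
    apply ENNReal.ofReal_le_ofReal
    have e : hits S l / s - P = (hits S l - s * P) / s := by field_simp
    rw [e, abs_div, abs_of_pos hs', lt_div_iff₀ hs'] at hl
    rw [← sq_abs (hits S l - s * P)]
    exact pow_le_pow_left₀ (by positivity) hl.le 2
  have h2 : ENNReal.ofReal c * prob (iid p s) {l | ¬ |hits S l / s - P| ≤ γ * P} ≤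
      ENNReal.ofReal (s * P) := (mul_le_mul_right (prob_mono hsub) _).trans h
  have e : ENNReal.ofReal (1 / (s * P * γ ^ 2)) = ENNReal.ofReal (s * P) / ENNReal.ofReal c := by
    rw [← ENNReal.ofReal_div_of_pos hc]
    congr 1
    simp only [c]
    field_simp
  rw [e, ENNReal.le_div_iff_mul_le (by simp [hc]) (by simp), mul_comm]
  exact h2

/-- From `|x| ≤ x² / (2u) + u / 2`; the free parameter `u` replaces a square root of the variance.
-/
theorem expect_abs_hits_le (p : PMF α) (S : Set α) {P u : ℝ} (hP : ENNReal.ofReal P = prob p S)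
    (h0 : 0 ≤ P) (hu : 0 < u) (s : ℕ) :
    expect (iid p s) (fun l => ENNReal.ofReal |hits S l - s * P|) ≤
      ENNReal.ofReal (s * P / (2 * u) + u / 2) := by
  have h : ∀ x : ℝ, ENNReal.ofReal |x| ≤
      ENNReal.ofReal (1 / (2 * u)) * ENNReal.ofReal (x ^ 2) + ENNReal.ofReal (u / 2) := by
    intro x
    rw [← ENNReal.ofReal_mul (by positivity), ← ENNReal.ofReal_add (by positivity) (by positivity)]
    apply ENNReal.ofReal_le_ofReal
    have : 1 / (2 * u) * x ^ 2 + u / 2 = (|x| ^ 2 + u ^ 2) / (2 * u) := by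
      rw [sq_abs]; field_simp
    rw [this, le_div_iff₀ (by positivity)]
    nlinarith [sq_nonneg (|x| - u)]
  refine (expect_mono fun l => h (hits S l - s * P)).trans ?_
  rw [expect_add, expect_const, expect_const_mul]
  refine (add_le_add_left (mul_le_mul_right (expect_sq_hits_le p S hP h0 s) _) _).trans ?_
  rw [← ENNReal.ofReal_mul (by positivity), ← ENNReal.ofReal_add (by positivity) (by positivity)]
  apply ENNReal.ofReal_le_ofReal
  apply le_of_eq
  field_simp

end Expect

theorem Implementable.iid {n q : ℕ} {α : Type} {p : PMF (Fin n) → PMF α}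
    (hp : Implementable q p) (s : ℕ) : Implementable (s * q) fun μ => iid (p μ) s := by
  induction s with
  | zero => exact Implementable.pure _
  | succ s ih =>
    rw [Nat.succ_mul, add_comm]
    exact hp.bind fun a => ih.map _

/-! ### Distributions as vectors: level functions in `L¹` -/

/-- The indicator function of `(0, w]`. -/
def level (w : ℝ) : ℝ → ℝ := (Set.Ioc 0 w).indicator fun _ => 1

theorem level_apply (w t : ℝ) : level w t = if 0 < t ∧ t ≤ w then 1 else 0 := by
  simp [level, Set.indicator, Set.mem_Ioc]

theorem integrable_level (w : ℝ) : Integrable (level w) volume :=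
  (integrable_indicator_iff measurableSet_Ioc).2 (integrableOn_const (by simp))

theorem integral_level_sub {v w : ℝ} (hv : 0 ≤ v) (hw : 0 ≤ w) :
    ∫ t, |level v t - level w t| = |v - w| := by
  wlog h : v ≤ w generalizing v w
  · rw [abs_sub_comm v w, ← this hw hv (le_of_not_ge h)]
    simp only [abs_sub_comm]
  have : (fun t => |level v t - level w t|) = (Set.Ioc v w).indicator fun _ => (1 : ℝ) := by
    ext t
    simp only [level_apply, Set.indicator, Set.mem_Ioc]
    split_ifs <;> first | (norm_num; done) | (exfalso; grind)
  rw [this, integral_indicator measurableSet_Ioc, abs_of_nonpos (by linarith)]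
  simp [h]

/-- The indicator function of `(0, w]` as an element of `L¹`. -/
def box (w : ℝ) : ℝ →₁[volume] ℝ := (integrable_level w).toL1 _

theorem norm_sum_box_sub {ι : Type*} (s : Finset ι) (a b : ι → ℝ) :
    ‖∑ i ∈ s, (box (a i) - box (b i))‖ = ∫ t, |∑ i ∈ s, (level (a i) t - level (b i) t)| := by
  have hi : ∀ s : Finset ι, Integrable (fun t => ∑ i ∈ s, (level (a i) t - level (b i) t)) volume :=
    fun s => integrable_finsetSum s fun i _ => (integrable_level _).sub (integrable_level _)
  have : ∑ i ∈ s, (box (a i) - box (b i)) = (hi s).toL1 _ := by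
    classical
    induction s using Finset.induction_on with
    | empty => simp only [Finset.sum_empty]; exact (Integrable.toL1_zero _).symm
    | insert i s his ih =>
      rw [Finset.sum_insert his, ih, box, box, ← Integrable.toL1_sub, ← Integrable.toL1_add]
      congr 1
      ext t
      simp [Finset.sum_insert his]
  rw [this, L1.norm_of_fun_eq_integral_norm]
  simp only [Real.norm_eq_abs]

theorem norm_box_sub {v w : ℝ} (hv : 0 ≤ v) (hw : 0 ≤ w) : ‖box v - box w‖ = |v - w| := by
  have := norm_sum_box_sub {()} (fun _ => v) (fun _ => w)
  simpa [integral_level_sub hv hw] using this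

theorem box_of_nonpos {w : ℝ} (hw : w ≤ 0) : box w = 0 := by
  have : level w = 0 := by ext t; simp [level, Set.Ioc_eq_empty_of_le hw]
  simp only [box, this]
  exact Integrable.toL1_zero _

theorem box_zero : box 0 = 0 := box_of_nonpos le_rfl

theorem norm_box {w : ℝ} (hw : 0 ≤ w) : ‖box w‖ = w := by
  simpa [box_zero, abs_of_nonneg hw] using norm_box_sub hw le_rfl

/-- The normalised indicator function of `(0, w]`. -/
def unitBox (w : ℝ) : ℝ →₁[volume] ℝ := w⁻¹ • box w

/-- No sign condition is imposed, so that arbitrary estimates, in particular 0, may be inserted; the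
vector is 0 for `w ≤ 0`. -/
theorem norm_unitBox_le (w : ℝ) : ‖unitBox w‖ ≤ 1 := by
  rcases lt_or_ge w 0 with hw | hw
  · rw [unitBox, box_of_nonpos hw.le, smul_zero, norm_zero]
    exact zero_le_one
  rw [unitBox, norm_smul, norm_box hw, norm_inv, Real.norm_of_nonneg hw]
  exact inv_mul_le_one

theorem smul_unitBox (w : ℝ) : w • unitBox w = box w := by
  rcases eq_or_ne w 0 with rfl | h
  · simp [box_zero]
  · rw [unitBox, smul_inv_smul₀ h]

/-- Two reals agree up to the factor `ρ ≤ 1`. -/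
def Close (ρ v w : ℝ) : Prop := ρ * v ≤ w ∧ ρ * w ≤ v

theorem Close.symm {ρ v w : ℝ} (h : Close ρ v w) : Close ρ w v := ⟨h.2, h.1⟩

theorem Close.mul {ρ ρ' v v' w w' : ℝ} (h : Close ρ v w) (h' : Close ρ' v' w') (hρ' : 0 ≤ ρ')
    (hv : 0 ≤ v) (hv' : 0 ≤ v') (hw : 0 ≤ w) (hw' : 0 ≤ w') :
    Close (ρ * ρ') (v * v') (w * w') := by
  constructor
  · calc ρ * ρ' * (v * v') = (ρ * v) * (ρ' * v') := by ring
      _ ≤ _ := mul_le_mul h.1 h'.1 (by positivity) hw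
  · calc ρ * ρ' * (w * w') = (ρ * w) * (ρ' * w') := by ring
      _ ≤ _ := mul_le_mul h.2 h'.2 (by positivity) hv

theorem Close.mono {ρ ρ' v w : ℝ} (h : Close ρ v w) (hρ : ρ' ≤ ρ) (hv : 0 ≤ v) (hw : 0 ≤ w) :
    Close ρ' v w :=
  ⟨(mul_le_mul_of_nonneg_right hρ hv).trans h.1, (mul_le_mul_of_nonneg_right hρ hw).trans h.2⟩

/-- For `v ≤ w`, the change of normalisation on `(0, v]` and the extra piece `(v, w]` each
contribute `1 - v / w`. -/
theorem norm_unitBox_sub_le {v w δ : ℝ} (hv : 0 < v) (hw : 0 < w) (h : Close (1 - δ) v w) :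
    ‖unitBox v - unitBox w‖ ≤ 2 * δ := by
  wlog hvw : v ≤ w generalizing v w
  · rw [norm_sub_rev]
    exact this hw hv h.symm (le_of_not_ge hvw)
  have e : unitBox v - unitBox w = (v⁻¹ - w⁻¹) • box v + w⁻¹ • (box v - box w) := by
    rw [unitBox, unitBox]; module
  have h1 : 0 ≤ v⁻¹ - w⁻¹ := sub_nonneg.2 (inv_anti₀ hv hvw)
  rw [e]
  refine (norm_add_le _ _).trans ?_
  rw [norm_smul, norm_smul, norm_box hv.le, norm_box_sub hv.le hw.le, Real.norm_of_nonneg h1,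
    Real.norm_of_nonneg (by positivity), abs_of_nonpos (by linarith)]
  have : (v⁻¹ - w⁻¹) * v + w⁻¹ * -(v - w) = 2 * (1 - v / w) := by field_simp; ring
  rw [this]
  have : 1 - δ ≤ v / w := (le_div_iff₀ hw).2 h.2
  linarith

theorem norm_unitBox_sub_le_two (v w : ℝ) : ‖unitBox v - unitBox w‖ ≤ 2 :=
  (norm_sub_le _ _).trans (by linarith [norm_unitBox_le v, norm_unitBox_le w])

/-! ### Sorting within classes -/

section Sorting

variable {α ι : Type*}

/-- A class-preserving permutation that maximises `∑ a i * b (σ i)` works: exchanging two values in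
one class cannot increase the sum. -/
theorem exists_perm_comonotone [Fintype α] (κ : α → ι) (a b : α → ℝ) :
    ∃ σ : Equiv.Perm α, (∀ i, κ (σ i) = κ i) ∧
      ∀ i j, κ i = κ j → 0 ≤ (a i - a j) * (b (σ i) - b (σ j)) := by
  classical
  obtain ⟨σ, hσ, hmax⟩ := Finset.exists_max_image
    (Finset.univ.filter fun σ : Equiv.Perm α => ∀ i, κ (σ i) = κ i)
    (fun σ => ∑ i, a i * b (σ i)) ⟨1, by simp⟩
  simp only [Finset.mem_filter, Finset.mem_univ, true_and] at hσ hmax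
  refine ⟨σ, hσ, fun i j hij => ?_⟩
  rcases eq_or_ne i j with rfl | hne
  · simp
  have h := hmax (σ * Equiv.swap i j) (by
    intro l
    rw [Equiv.Perm.mul_apply, hσ]
    rcases eq_or_ne l i with rfl | hli
    · rw [Equiv.swap_apply_left, hij]
    rcases eq_or_ne l j with rfl | hlj
    · rw [Equiv.swap_apply_right, hij]
    · rw [Equiv.swap_apply_of_ne_of_ne hli hlj])
  have hd : ∑ l, (a l * b (σ l) - a l * b ((σ * Equiv.swap i j) l)) =
      (a i * b (σ i) - a i * b (σ j)) + (a j * b (σ j) - a j * b (σ i)) := by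
    rw [← Finset.sum_subset (Finset.subset_univ {i, j}), Finset.sum_pair hne]
    · simp
    · intro l _ hl
      simp only [Finset.mem_insert, Finset.mem_singleton, not_or] at hl
      rw [Equiv.Perm.mul_apply, Equiv.swap_apply_of_ne_of_ne hl.1 hl.2, sub_self]
  rw [Finset.sum_sub_distrib] at hd
  nlinarith

theorem abs_sum_eq_sum_abs_of_same_sign {s : Finset α} {f : α → ℝ}
    (h : ∀ i ∈ s, ∀ j ∈ s, 0 < f i → 0 ≤ f j) : |∑ i ∈ s, f i| = ∑ i ∈ s, |f i| := by
  by_cases hp : ∃ i ∈ s, 0 < f i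
  · obtain ⟨i, hi, hfi⟩ := hp
    rw [abs_of_nonneg (Finset.sum_nonneg fun j hj => h i hi j hj hfi)]
    exact Finset.sum_congr rfl fun j hj => (abs_of_nonneg (h i hi j hj hfi)).symm
  · push Not at hp
    rw [abs_of_nonpos (Finset.sum_nonpos hp), ← Finset.sum_neg_distrib]
    exact Finset.sum_congr rfl fun j hj => (abs_of_nonpos (hp j hj)).symm

/-- Under the comonotone matching, at each height `t` the differences of indicators within one class
never take both signs. The absolute value therefore commutes with the sum pointwise, and integration
over `t` gives the equality. -/
theorem exists_perm_sum_abs_sub_eq [Fintype α] [Fintype ι] [DecidableEq ι] (κ : α → ι) {a b : α → ℝ}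
    (ha : ∀ i, 0 ≤ a i) (hb : ∀ i, 0 ≤ b i) :
    ∃ σ : Equiv.Perm α, (∀ i, κ (σ i) = κ i) ∧
      ∑ i, |a i - b (σ i)| =
        ∑ r, ‖∑ i with κ i = r, box (a i) - ∑ i with κ i = r, box (b i)‖ := by
  obtain ⟨σ, hσ, hmono⟩ := exists_perm_comonotone κ a b
  refine ⟨σ, hσ, ?_⟩
  rw [← Finset.sum_fiberwise_of_maps_to (g := κ) (t := Finset.univ) (fun _ _ => Finset.mem_univ _)]
  refine Finset.sum_congr rfl fun r _ => ?_
  have hperm : ∑ i with κ i = r, box (b i) = ∑ i with κ i = r, box (b (σ i)) := by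
    refine (Finset.sum_equiv σ (fun i => ?_) fun i _ => rfl).symm
    simp [hσ]
  rw [hperm, ← Finset.sum_sub_distrib, norm_sum_box_sub]
  have hsign : ∀ t, |∑ i with κ i = r, (level (a i) t - level (b (σ i)) t)| =
      ∑ i with κ i = r, |level (a i) t - level (b (σ i)) t| := by
    intro t
    apply abs_sum_eq_sum_abs_of_same_sign
    intro i hi j hj hpos
    simp only [Finset.mem_filter, Finset.mem_univ, true_and] at hi hj
    by_contra hneg
    have hm := hmono i j (hi.trans hj.symm)
    simp only [level_apply] at hpos hneg
    have h1 : (0 < t ∧ t ≤ a i) ∧ ¬ (0 < t ∧ t ≤ b (σ i)) := by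
      split_ifs at hpos <;> first | tauto | (norm_num at hpos)
    have h2 : ¬ (0 < t ∧ t ≤ a j) ∧ (0 < t ∧ t ≤ b (σ j)) := by
      split_ifs at hneg <;> first | tauto | (norm_num at hneg)
    have h3 : b (σ i) < t := by by_contra h; exact h1.2 ⟨h1.1.1, not_lt.1 h⟩
    have h4 : a j < t := by by_contra h; exact h2.1 ⟨h1.1.1, not_lt.1 h⟩
    nlinarith [h1.1.2, h2.2.2]
  simp only [hsign]
  rw [integral_finsetSum]
  swap
  · exact fun i _ => ((integrable_level _).sub (integrable_level _)).abs
  exact Finset.sum_congr rfl fun i _ => (integral_level_sub (ha i) (hb _)).symm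

end Sorting

/-! ### Labelled level functions -/

section Labelled

variable {ι : Type} [DecidableEq ι]

/-- `ι`-indexed families of `L¹` functions with the sum of the norms. -/
abbrev LabelledL1 (ι : Type) : Type := PiLp 1 fun _ : ι => ℝ →₁[volume] ℝ

/-- The family that has the value `f` at `r` and vanishes elsewhere. -/
def atLabel (r : ι) (f : ℝ →₁[volume] ℝ) : LabelledL1 ι := WithLp.toLp 1 (Pi.single r f)

theorem norm_atLabel [Fintype ι] (r : ι) (f : ℝ →₁[volume] ℝ) : ‖atLabel r f‖ = ‖f‖ := by
  rw [PiLp.norm_eq_of_L1, Finset.sum_eq_single r]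
  · simp [atLabel]
  · intro b _ hb
    simp [atLabel, hb]
  · simp

theorem atLabel_sub (r : ι) (f g : ℝ →₁[volume] ℝ) :
    atLabel r (f - g) = atLabel r f - atLabel r g := by
  rw [atLabel, Pi.single_sub]; rfl

theorem smul_atLabel (c : ℝ) (r : ι) (f : ℝ →₁[volume] ℝ) :
    c • atLabel r f = atLabel r (c • f) := by
  rw [atLabel, atLabel, Pi.single_smul]; rfl

theorem sum_atLabel_apply {α : Type*} [Fintype α] (κ : α → ι) (f : α → ℝ →₁[volume] ℝ) (r : ι) :
    (∑ i, atLabel (κ i) (f i)) r = ∑ i with κ i = r, f i := by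
  rw [WithLp.ofLp_sum, Finset.sum_apply, Finset.sum_filter]
  refine Finset.sum_congr rfl fun i _ => ?_
  simp only [atLabel, Pi.single_apply, eq_comm]

end Labelled

/-! ### Empirical averages of vectors -/

section Empirical

variable {α ι V : Type} [Fintype ι] [NormedAddCommGroup V] [NormedSpace ℝ V]

theorem enorm_sum_sub_sum_hits_le (c : α → ι) (Φ : α → V) (Ψ : ι → V) (l : List α) :
    ‖(l.map Φ).sum - ∑ r, hits {a | c a = r} l • Ψ r‖ₑ ≤
      (l.map fun a => ‖Φ a - Ψ (c a)‖ₑ).sum := by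
  classical
  induction l with
  | nil => simp [hits]
  | cons a l ih =>
    have e : ∑ r, hits {a | c a = r} (a :: l) • Ψ r =
        Ψ (c a) + ∑ r, hits {a | c a = r} l • Ψ r := by
      simp only [hits_cons, add_smul, Finset.sum_add_distrib, Set.mem_ofPred_eq, ite_smul, one_smul,
        zero_smul, Finset.sum_ite_eq, Finset.mem_univ, if_true]
    rw [e, List.map_cons, List.map_cons, List.sum_cons, List.sum_cons, add_sub_add_comm]
    exact (enorm_add_le _ _).trans (add_le_add_right ih _)

theorem enorm_sum_hits_sub_le {c : α → ι} {Ψ : ι → V} (hΨ : ∀ r, ‖Ψ r‖ ≤ 1) (P : ι → ℝ) (s : ℕ)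
    (l : List α) :
    ‖∑ r, hits {a | c a = r} l • Ψ r - (s : ℝ) • ∑ r, P r • Ψ r‖ₑ ≤
      ∑ r, ENNReal.ofReal |hits {a | c a = r} l - s * P r| := by
  rw [Finset.smul_sum, ← Finset.sum_sub_distrib]
  refine (enorm_sum_le _ _).trans (Finset.sum_le_sum fun r _ => ?_)
  rw [smul_smul, ← sub_smul, enorm_smul, ← Real.enorm_eq_ofReal_abs]
  have : ‖Ψ r‖ₑ ≤ 1 := by
    rw [← ofReal_norm]
    exact ENNReal.ofReal_le_one.2 (hΨ r)
  exact (mul_le_mul_right this _).trans (mul_one _).le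

/-- The expected error of an empirical average of `card ι * d ^ 2` vectors, when the vectors are
approximated by vectors that depend on a label in `ι` only. -/
theorem expect_enorm_average_sub_le (p : PMF α) {c : α → ι} (Φ : α → V) {Ψ : ι → V}
    (hΨ : ∀ r, ‖Ψ r‖ ≤ 1) {P : ι → ℝ} (hP : ∀ r, ENNReal.ofReal (P r) = prob p {a | c a = r})
    (hP0 : ∀ r, 0 ≤ P r) (hP1 : ∑ r, P r = 1) {d s : ℕ} (hd : 0 < d)
    (hs : s = Fintype.card ι * d ^ 2) :
    expect (iid p s) (fun l => ‖(s : ℝ)⁻¹ • (l.map Φ).sum - ∑ r, P r • Ψ r‖ₑ) ≤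
      expect p (fun a => ‖Φ a - Ψ (c a)‖ₑ) + ENNReal.ofReal (1 / d) := by
  have hcard : 0 < Fintype.card ι := by
    rw [Fintype.card_pos_iff]
    by_contra h
    rw [not_nonempty_iff] at h
    simp at hP1
  have hd' : (0 : ℝ) < d := by exact_mod_cast hd
  have hs0 : (0 : ℝ) < s := by rw [hs]; exact_mod_cast (by positivity)
  have hpath : ∀ l : List α, ‖(s : ℝ)⁻¹ • (l.map Φ).sum - ∑ r, P r • Ψ r‖ₑ ≤
      ENNReal.ofReal (s : ℝ)⁻¹ * ((l.map fun a => ‖Φ a - Ψ (c a)‖ₑ).sum +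
        ∑ r, ENNReal.ofReal |hits {a | c a = r} l - s * P r|) := by
    intro l
    have e : (s : ℝ)⁻¹ • (l.map Φ).sum - ∑ r, P r • Ψ r =
        (s : ℝ)⁻¹ • (((l.map Φ).sum - ∑ r, hits {a | c a = r} l • Ψ r) +
          (∑ r, hits {a | c a = r} l • Ψ r - (s : ℝ) • ∑ r, P r • Ψ r)) := by
      rw [sub_add_sub_cancel, smul_sub, inv_smul_smul₀ hs0.ne']
    rw [e, enorm_smul, Real.enorm_eq_ofReal (by positivity)]
    exact mul_le_mul_right ((enorm_add_le _ _).trans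
      (add_le_add (enorm_sum_sub_sum_hits_le c Φ Ψ l) (enorm_sum_hits_sub_le hΨ P s l))) _
  refine (expect_mono hpath).trans ?_
  rw [expect_const_mul, expect_add, expect_iid_sum, expect_finset_sum, mul_add, ← mul_assoc]
  have h1 : ENNReal.ofReal (s : ℝ)⁻¹ * (s : ℝ≥0∞) = 1 := by
    rw [← ENNReal.ofReal_natCast, ← ENNReal.ofReal_mul (by positivity), inv_mul_cancel₀ hs0.ne',
      ENNReal.ofReal_one]
  rw [h1, one_mul]
  refine add_le_add_right ?_ _
  -- The bound on the mean deviation of each count is used with `u = d`; as `s = card ι * d ^ 2`,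
  -- its two terms contribute `1 / (2d)` each after summation.
  calc ENNReal.ofReal (s : ℝ)⁻¹ *
        ∑ r, expect (iid p s) (fun l => ENNReal.ofReal |hits {a | c a = r} l - s * P r|)
      ≤ ENNReal.ofReal (s : ℝ)⁻¹ * ∑ r, ENNReal.ofReal (s * P r / (2 * d) + d / 2) := by
        gcongr with r
        exact expect_abs_hits_le p _ (hP r) (hP0 r) hd' s
    _ = ENNReal.ofReal (1 / d) := by
        rw [← ENNReal.ofReal_sum_of_nonneg, ← ENNReal.ofReal_mul (by positivity),
          Finset.sum_add_distrib, ← Finset.sum_div, ← Finset.mul_sum, hP1]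
        · congr 1
          rw [Finset.sum_const, Finset.card_univ, nsmul_eq_mul]
          have : (s : ℝ) = Fintype.card ι * d ^ 2 := by exact_mod_cast hs
          rw [this]
          have : (0 : ℝ) < Fintype.card ι := by exact_mod_cast hcard
          field_simp
          norm_num
        · intro r _
          have := hP0 r
          positivity

end Empirical

/-! ### Weights of sets under a distribution over `[n]` -/

section Mass

variable {n : ℕ} (μ : PMF (Fin n))

/-- The weight of a set. -/
def mass (A : Finset (Fin n)) : ℝ := ∑ i ∈ A, (μ i).toReal

theorem mass_nonneg (A : Finset (Fin n)) : 0 ≤ mass μ A :=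
  Finset.sum_nonneg fun _ _ => ENNReal.toReal_nonneg

theorem mass_mono {A B : Finset (Fin n)} (h : A ⊆ B) : mass μ A ≤ mass μ B :=
  Finset.sum_le_sum_of_subset_of_nonneg h fun _ _ _ => ENNReal.toReal_nonneg

theorem ofReal_mass (A : Finset (Fin n)) : ENNReal.ofReal (mass μ A) = ∑ i ∈ A, μ i := by
  rw [mass, ENNReal.ofReal_sum_of_nonneg fun _ _ => ENNReal.toReal_nonneg]
  exact Finset.sum_congr rfl fun i _ => ENNReal.ofReal_toReal (μ.apply_ne_top i)

theorem mass_univ : mass μ Finset.univ = 1 := by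
  have h := ofReal_mass μ Finset.univ
  rw [← tsum_fintype (L := .unconditional _), μ.tsum_coe] at h
  simpa using h

theorem prob_eq_ofReal_mass (S : Set (Fin n)) [DecidablePred (· ∈ S)] :
    prob μ S = ENNReal.ofReal (mass μ {i | i ∈ S}) := by
  rw [ofReal_mass, prob, expect_fintype, Finset.sum_filter]
  refine Finset.sum_congr rfl fun i _ => ?_
  by_cases h : i ∈ S <;> simp [h]

theorem condOracle_univ (h : (Finset.univ : Finset (Fin n)).Nonempty) :
    condOracle μ Finset.univ h = μ := by
  have hs : ∃ i ∈ ((Finset.univ : Finset (Fin n)) : Set (Fin n)), i ∈ μ.support := by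
    obtain ⟨i, hi⟩ := μ.support_nonempty
    exact ⟨i, by simp, hi⟩
  rw [condOracle, dif_pos hs]
  ext i
  rw [PMF.filter_apply, Finset.coe_univ, Set.indicator_univ, μ.tsum_coe, inv_one, mul_one]

theorem prob_condOracle {A B : Finset (Fin n)} (hA : A.Nonempty) (hBA : B ⊆ A)
    (h : 0 < mass μ A) :
    prob (condOracle μ A hA) B = ENNReal.ofReal (mass μ B / mass μ A) := by
  have hs : ∃ i ∈ (A : Set (Fin n)), i ∈ μ.support := by
    by_contra hc
    push Not at hc
    refine h.ne' (Finset.sum_eq_zero fun i hi => ?_)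
    simp [(PMF.apply_eq_zero_iff μ i).2 (hc i hi)]
  rw [condOracle, dif_pos hs, ENNReal.ofReal_div_of_pos h, ofReal_mass, ofReal_mass, prob,
    expect_fintype, div_eq_mul_inv, Finset.sum_mul]
  rw [← Finset.sum_subset (Finset.subset_univ B)]
  · refine Finset.sum_congr rfl fun i hi => ?_
    have hi' : i ∈ (A : Set (Fin n)) := hBA hi
    rw [PMF.filter_apply, Set.indicator_of_mem hi', Set.indicator_of_mem (by exact hi), Pi.one_apply,
      mul_one, tsum_fintype]
    congr 2
    rw [← Finset.sum_subset (Finset.subset_univ A)]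
    · exact Finset.sum_congr rfl fun j hj => Set.indicator_of_mem (by exact hj) _
    · exact fun j _ hj => Set.indicator_of_notMem (by exact hj) _
  · intro i _ hi
    rw [Set.indicator_of_notMem (by exact hi), mul_zero]

end Mass

/-! ### Estimating the weight of a point by dyadic descent -/

section Estimate

variable {n : ℕ}

/-- The dyadic block of length `2 ^ e` around `y`. -/
def block (e : ℕ) (y : Fin n) : Finset (Fin n) := {i | (i : ℕ) / 2 ^ e = (y : ℕ) / 2 ^ e}

theorem mem_block {e : ℕ} {y i : Fin n} : i ∈ block e y ↔ (i : ℕ) / 2 ^ e = (y : ℕ) / 2 ^ e := by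
  simp [block]

theorem self_mem_block (e : ℕ) (y : Fin n) : y ∈ block e y := mem_block.2 rfl

theorem block_nonempty (e : ℕ) (y : Fin n) : (block e y).Nonempty := ⟨y, self_mem_block e y⟩

theorem block_subset_succ (e : ℕ) (y : Fin n) : block e y ⊆ block (e + 1) y := by
  intro i hi
  rw [mem_block] at hi ⊢
  rw [pow_succ, ← Nat.div_div_eq_div_mul, ← Nat.div_div_eq_div_mul, hi]

theorem block_zero (y : Fin n) : block 0 y = {y} := by
  ext i; simp [mem_block, Fin.ext_iff]

theorem block_eq_univ {e : ℕ} (h : n < 2 ^ e) (y : Fin n) : block e y = Finset.univ := by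
  ext i
  simp [mem_block, Nat.div_eq_of_lt (i.2.trans h), Nat.div_eq_of_lt (y.2.trans h)]

/-- Estimate the weight of `y` relative to its block of length `2 ^ e` as a product of empirical
frequencies, each obtained from `m` conditional samples. -/
def estimate (m : ℕ) (y : Fin n) (μ : PMF (Fin n)) : ℕ → PMF ℝ
  | 0 => PMF.pure 1
  | e + 1 => (estimate m y μ e).bind fun w =>
      (iid (condOracle μ (block (e + 1) y) (block_nonempty _ _)) m).map fun l =>
        w * (hits (block e y) l / m)

theorem implementable_estimate (m : ℕ) (y : Fin n) (e : ℕ) :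
    Implementable (e * m) fun μ => estimate m y μ e := by
  induction e with
  | zero => exact Implementable.pure _
  | succ e ih =>
    rw [Nat.succ_mul]
    refine ih.bind fun w => Implementable.map ?_ _
    simpa only [mul_one] using (Implementable.oracle (block_nonempty (e + 1) y)).iid m

/-- Each factor estimates a true ratio of at least `β`, so Chebyshev bounds its relative error by
`γ` with failure probability at most `1 / (m β γ²)`. Failures add over the levels, while accuracies
multiply. -/
theorem prob_estimate_not_close_le {m : ℕ} (hm : 0 < m) {μ : PMF (Fin n)} {y : Fin n}
    (hy : μ y ≠ 0) {β γ : ℝ} (hβ : 0 < β) (hγ : 0 < γ) (hγ1 : γ < 1) (e : ℕ)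
    (hβy : ∀ j < e, β * mass μ (block (j + 1) y) ≤ mass μ (block j y)) :
    prob (estimate m y μ e) {w | ¬ Close ((1 - γ) ^ e) ((μ y).toReal / mass μ (block e y)) w} ≤
      e * ENNReal.ofReal (1 / (m * β * γ ^ 2)) := by
  have hy0 : 0 < (μ y).toReal := ENNReal.toReal_pos hy (μ.apply_ne_top y)
  have hpos : ∀ j, 0 < mass μ (block j y) := fun j => by
    refine lt_of_lt_of_le hy0 ?_
    exact Finset.single_le_sum (f := fun i => (μ i).toReal) (fun _ _ => ENNReal.toReal_nonneg)
      (self_mem_block j y)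
  induction e with
  | zero =>
    have : mass μ (block 0 y) = (μ y).toReal := by rw [block_zero, mass, Finset.sum_singleton]
    rw [this, div_self hy0.ne']
    simp [estimate, prob, expect_pure, Close]
  | succ e ih =>
    rw [estimate, Nat.cast_succ, add_mul, one_mul]
    refine (prob_bind_le (T := {w | ¬ Close ((1 - γ) ^ e) ((μ y).toReal / mass μ (block e y)) w})
      fun w _ hw => ?_).trans (add_le_add_left (ih fun j hj => hβy j (hj.trans e.lt_succ_self)) _)
    simp only [Set.mem_ofPred_eq, not_not] at hw
    rw [prob_map]
    set P : ℝ := mass μ (block e y) / mass μ (block (e + 1) y) with hPdef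
    have hP0 : 0 < P := div_pos (hpos _) (hpos _)
    have hβP : β ≤ P := (le_div_iff₀ (hpos _)).2 (hβy e e.lt_succ_self)
    have hP := prob_condOracle μ (block_nonempty (e + 1) y) (block_subset_succ e y) (hpos _)
    refine (prob_mono ?_).trans ((prob_hits_far_le _ (block e y : Set (Fin n)) hP.symm hP0 hγ hm).trans
      (ENNReal.ofReal_le_ofReal ?_))
    · intro l hl
      simp only [Set.mem_preimage, Set.mem_ofPred_eq] at hl ⊢
      intro hclose
      apply hl
      have e1 : (μ y).toReal / mass μ (block (e + 1) y) = (μ y).toReal / mass μ (block e y) * P := by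
        have := hpos e
        have := hpos (e + 1)
        rw [hPdef]; field_simp
      rw [e1, pow_succ]
      have hv : 0 ≤ (μ y).toReal / mass μ (block e y) := (div_pos hy0 (hpos _)).le
      have hγ' : 0 ≤ 1 - γ := by linarith
      rw [abs_le] at hclose
      have hh : 0 ≤ hits (block e y : Set (Fin n)) l / m :=
        div_nonneg (hits_nonneg _ _) (Nat.cast_nonneg m)
      refine hw.mul ⟨by linarith, ?_⟩ hγ' hv hP0.le ((by positivity : (0 : ℝ) ≤ _).trans hw.1) hh
      -- The upper half of closeness comes from `(1 - γ) * (1 + γ) ≤ 1`.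
      nlinarith [mul_nonneg hγ.le hγ.le]
    · have : (0 : ℝ) < m := by exact_mod_cast hm
      gcongr

/-- A light block weighs less than `β` times its parent. Every parent has at most two halves and the
parents partition `[n]`, so light blocks weigh at most `2β` together. -/
theorem prob_light_block_le (μ : PMF (Fin n)) {β : ℝ} (hβ : 0 ≤ β) (e : ℕ) :
    prob μ {y | ¬ β * mass μ (block (e + 1) y) ≤ mass μ (block e y)} ≤ ENNReal.ofReal (2 * β) := by
  classical
  rw [prob_eq_ofReal_mass]
  apply ENNReal.ofReal_le_ofReal
  simp only [Set.mem_ofPred_eq, not_le]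
  set K : Finset ℕ := (Finset.univ : Finset (Fin n)).image fun y : Fin n => (y : ℕ) / 2 ^ e
  set L : Finset (Fin n) := {y | mass μ (block e y) < β * mass μ (block (e + 1) y)}
  have h1 : mass μ L = ∑ c ∈ K, ∑ y ∈ L.filter fun y : Fin n => (y : ℕ) / 2 ^ e = c, (μ y).toReal := by
    rw [mass, Finset.sum_fiberwise_of_maps_to]
    intro y _
    exact Finset.mem_image_of_mem _ (Finset.mem_univ y)
  have h2 : ∀ c ∈ K, ∑ y ∈ L.filter fun y : Fin n => (y : ℕ) / 2 ^ e = c, (μ y).toReal ≤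
      β * ∑ i ∈ Finset.univ.filter fun i : Fin n => (i : ℕ) / 2 ^ (e + 1) = c / 2, (μ i).toReal := by
    intro c _
    rcases Finset.eq_empty_or_nonempty (L.filter fun y : Fin n => (y : ℕ) / 2 ^ e = c) with h | ⟨y, hy⟩
    · rw [h, Finset.sum_empty]
      exact mul_nonneg hβ (Finset.sum_nonneg fun _ _ => ENNReal.toReal_nonneg)
    · obtain ⟨hyL, rfl⟩ := Finset.mem_filter.1 hy
      have hlt := (Finset.mem_filter.1 hyL).2
      have e1 : mass μ (block (e + 1) y) =
          ∑ i ∈ Finset.univ.filter fun i : Fin n => (i : ℕ) / 2 ^ (e + 1) = (y : ℕ) / 2 ^ e / 2,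
            (μ i).toReal := by
        rw [Nat.div_div_eq_div_mul, ← pow_succ]; rfl
      rw [← e1]
      refine le_trans ?_ hlt.le
      refine mass_mono μ fun i hi => mem_block.2 (Finset.mem_filter.1 hi).2
  have h3 : ∑ c ∈ K, ∑ i ∈ Finset.univ.filter fun i : Fin n => (i : ℕ) / 2 ^ (e + 1) = c / 2, (μ i).toReal ≤ 2 := by
    simp only [Finset.sum_filter]
    rw [Finset.sum_comm]
    have : ∀ i : Fin n, ∑ c ∈ K, (if (i : ℕ) / 2 ^ (e + 1) = c / 2 then (μ i).toReal else 0) ≤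
        2 * (μ i).toReal := by
      intro i
      rw [← Finset.sum_filter, Finset.sum_const, nsmul_eq_mul]
      have hsub : {c ∈ K | (i : ℕ) / 2 ^ (e + 1) = c / 2} ⊆
          {2 * ((i : ℕ) / 2 ^ (e + 1)), 2 * ((i : ℕ) / 2 ^ (e + 1)) + 1} := by
        intro c hc
        have := (Finset.mem_filter.1 hc).2
        simp only [Finset.mem_insert, Finset.mem_singleton]
        omega
      have hc := (Finset.card_le_card hsub).trans Finset.card_le_two
      gcongr
      exact_mod_cast hc
    refine (Finset.sum_le_sum fun i _ => this i).trans ?_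
    rw [← Finset.mul_sum]
    have := mass_univ μ
    rw [mass] at this
    rw [this, mul_one]
  rw [h1]
  refine (Finset.sum_le_sum h2).trans ?_
  rw [← Finset.mul_sum]
  nlinarith

/-- The law of a point drawn from `μ` together with an estimate of its weight. -/
def weightedSample (m h : ℕ) (μ : PMF (Fin n)) : PMF (Fin n × ℝ) :=
  μ.bind fun y => (estimate m y μ h).map fun w => (y, w)

theorem prob_weightedSample_not_close_le {m h d : ℕ} (hh : 0 < h) (hd : 1 < d) (hn : n < 2 ^ h)
    (hm : m = 2 * h ^ 4 * d ^ 4) (μ : PMF (Fin n)) :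
    prob (weightedSample m h μ) {a | ¬ Close (1 - 1 / d) (μ a.1).toReal a.2} ≤
      ENNReal.ofReal (2 / d) := by
  have hh' : (1 : ℝ) ≤ h := by exact_mod_cast hh
  have hd' : (1 : ℝ) < d := by exact_mod_cast hd
  have hm0 : 0 < m := by rw [hm]; positivity
  -- Light blocks over all `h` levels cost `h * 2β = 1 / d`. Since `m * β * γ² = h * d`, the
  -- Chebyshev failures cost another `1 / d`. The choice of `γ` gives `(1 - γ) ^ h ≥ 1 - 1 / d` by
  -- Bernoulli.
  set β : ℝ := 1 / (2 * h * d) with hβ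
  set γ : ℝ := 1 / (h * d) with hγ
  have hβ0 : 0 < β := by positivity
  have hγ0 : 0 < γ := by positivity
  have hγ1 : γ < 1 := by
    rw [hγ, div_lt_one (by positivity)]
    nlinarith
  have hbern : 1 - 1 / (d : ℝ) ≤ (1 - γ) ^ h := by
    have := one_add_mul_le_pow (a := -γ) (by linarith) h
    have e : (h : ℝ) * γ = 1 / d := by rw [hγ]; field_simp
    rw [← sub_eq_add_neg, mul_neg, e, ← sub_eq_add_neg] at this
    exact this
  have key := prob_bind_le (p := μ) (g := fun y => (estimate m y μ h).map fun w => (y, w))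
    (S := {a | ¬ Close (1 - 1 / d) (μ a.1).toReal a.2})
    (T := ⋃ j : Fin h, {y | ¬ β * mass μ (block (j + 1) y) ≤ mass μ (block j y)})
    (c := h * ENNReal.ofReal (1 / (m * β * γ ^ 2))) (fun y hy hyT => by
      rw [prob_map]
      refine (prob_mono ?_).trans
        (prob_estimate_not_close_le hm0 hy hβ0 hγ0 hγ1 h fun j hj => ?_)
      · intro w hw
        simp only [Set.mem_preimage, Set.mem_ofPred_eq] at hw ⊢
        rw [block_eq_univ hn, mass_univ, div_one]
        intro hc
        have hy0 : 0 ≤ (μ y).toReal := ENNReal.toReal_nonneg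
        have : 0 ≤ (1 - γ) ^ h := pow_nonneg (by linarith) _
        exact hw (hc.mono hbern hy0 ((by positivity : (0 : ℝ) ≤ _).trans hc.1))
      · by_contra hc
        exact hyT (Set.mem_iUnion.2 ⟨⟨j, hj⟩, hc⟩))
  refine key.trans ((add_le_add_left ((prob_iUnion_le μ _).trans
    (Finset.sum_le_sum fun (j : Fin h) _ => prob_light_block_le μ hβ0.le j)) _).trans ?_)
  rw [Finset.sum_const, Finset.card_univ, Fintype.card_fin, nsmul_eq_mul, ← ENNReal.ofReal_natCast,
    ← ENNReal.ofReal_mul (by positivity), ← ENNReal.ofReal_mul (by positivity),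
    ← ENNReal.ofReal_add (by positivity) (by positivity)]
  apply ENNReal.ofReal_le_ofReal
  have hmr : (m : ℝ) = 2 * h ^ 4 * d ^ 4 := by exact_mod_cast hm
  rw [hmr, hβ, hγ]
  apply le_of_eq
  field_simp
  norm_num

theorem expect_weightedSample_unitBox_le {m h d : ℕ} (hh : 0 < h) (hd : 1 < d) (hn : n < 2 ^ h)
    (hm : m = 2 * h ^ 4 * d ^ 4) (μ : PMF (Fin n)) :
    expect (weightedSample m h μ) (fun a => ‖unitBox a.2 - unitBox (μ a.1).toReal‖ₑ) ≤
      ENNReal.ofReal (6 / d) := by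
  have hd' : (1 : ℝ) < d := by exact_mod_cast hd
  have hbound : ∀ a : Fin n × ℝ, ‖unitBox a.2 - unitBox (μ a.1).toReal‖ₑ ≤ ENNReal.ofReal 2 := by
    intro a
    rw [← ofReal_norm]
    exact ENNReal.ofReal_le_ofReal (norm_unitBox_sub_le_two _ _)
  have hclose : ∀ a : Fin n × ℝ, weightedSample m h μ a ≠ 0 →
      a ∉ {a : Fin n × ℝ | ¬ Close (1 - 1 / d) (μ a.1).toReal a.2} →
      ‖unitBox a.2 - unitBox (μ a.1).toReal‖ₑ ≤ ENNReal.ofReal (2 / d) := by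
    intro a ha hS
    simp only [Set.mem_ofPred_eq, not_not] at hS
    have hpos : 0 < (μ a.1).toReal := by
      refine ENNReal.toReal_pos (fun h0 => ha ?_) (μ.apply_ne_top _)
      rw [weightedSample, PMF.bind_apply]
      refine ENNReal.tsum_eq_zero.2 fun y => ?_
      by_cases hy : y = a.1
      · rw [hy, h0, zero_mul]
      · rw [mul_eq_zero]
        right
        rw [PMF.apply_eq_zero_iff, PMF.support_map]
        rintro ⟨w, -, hw⟩
        exact hy (by rw [← hw])
    have hρ : 0 < 1 - 1 / (d : ℝ) := by
      rw [sub_pos, div_lt_one (by linarith)]; exact hd'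
    have hw : 0 < a.2 := lt_of_lt_of_le (by positivity) hS.1
    rw [← ofReal_norm]
    refine ENNReal.ofReal_le_ofReal ((norm_unitBox_sub_le hw hpos hS.symm).trans (le_of_eq ?_))
    ring
  -- A bad estimate costs at most 2 and has probability at most `2 / d`; a good one costs at most `2
  -- / d`.
  refine (expect_le_mul_add hbound hclose).trans ((add_le_add_left (mul_le_mul_right
    (prob_weightedSample_not_close_le hh hd hn hm μ) _) _).trans ?_)
  rw [← ENNReal.ofReal_mul (by norm_num), ← ENNReal.ofReal_add (by positivity) (by positivity)]
  apply ENNReal.ofReal_le_ofReal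
  apply le_of_eq
  ring

end Estimate

/-! ### The partition cut out by a list of points -/

section FineLabel

variable {n : ℕ}

theorem countP_lt_countP {α : Type*} {p q : α → Bool} {l : List α}
    (h : ∀ x ∈ l, p x = true → q x = true) {x : α} (hx : x ∈ l) (hp : p x = false)
    (hq : q x = true) : l.countP p < l.countP q := by
  induction l with
  | nil => simp at hx
  | cons a l ih =>
    have hl : ∀ x ∈ l, p x = true → q x = true := fun x hx => h x (List.mem_cons_of_mem _ hx)
    have hle := List.countP_mono_left hl
    rw [List.countP_cons, List.countP_cons]
    rcases List.mem_cons.1 hx with rfl | hx'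
    · simp [hp, hq]; omega
    · have := ih hl hx'
      have ha := h a List.mem_cons_self
      split_ifs with h1 h2 <;> first | omega | (exact absurd (ha h1) h2)

/-- The points of `xs` cut `[n]` into intervals, and every point of `xs` is separated from all
others; this is the position of the interval of `i` in that partition. -/
def fineLabel (xs : List (Fin n)) (i : Fin n) : Fin (2 * xs.length + 1) :=
  ⟨xs.countP (· < i) + xs.countP (· ≤ i), by
    have h1 : xs.countP (· < i) ≤ xs.length := List.countP_le_length
    have h2 : xs.countP (· ≤ i) ≤ xs.length := List.countP_le_length
    omega⟩

theorem countP_lt_mono (xs : List (Fin n)) {i j : Fin n} (h : i ≤ j) :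
    xs.countP (· < i) ≤ xs.countP (· < j) :=
  List.countP_mono_left fun x _ hx => by
    simp only [decide_eq_true_eq] at hx ⊢; exact hx.trans_le h

theorem countP_le_mono (xs : List (Fin n)) {i j : Fin n} (h : i ≤ j) :
    xs.countP (· ≤ i) ≤ xs.countP (· ≤ j) :=
  List.countP_mono_left fun x _ hx => by
    simp only [decide_eq_true_eq] at hx ⊢; exact hx.trans h

theorem fineLabel_mono (xs : List (Fin n)) : Monotone (fineLabel xs) := fun _ _ h =>
  Fin.mk_le_mk.2 (add_le_add (countP_lt_mono xs h) (countP_le_mono xs h))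

/-- Both counts are monotone, so equal labels mean that neither grows from `i` to `j`. A sample in
`[i, j)` would raise the strict count, and a sample at `j` the non-strict one. -/
theorem notMem_of_fineLabel_eq {xs : List (Fin n)} {i j : Fin n} (hij : i < j)
    (h : fineLabel xs i = fineLabel xs j) {x : Fin n} (hx : x ∈ xs) : x ∉ Finset.Icc i j := by
  intro hxm
  rw [Finset.mem_Icc] at hxm
  have h1 := countP_lt_mono xs hij.le
  have h2 := countP_le_mono xs hij.le
  have h3 : xs.countP (· < i) + xs.countP (· ≤ i) = xs.countP (· < j) + xs.countP (· ≤ j) :=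
    congrArg Fin.val h
  rcases hxm.2.lt_or_eq with hlt | rfl
  · have : xs.countP (· < i) < xs.countP (· < j) :=
      countP_lt_countP (x := x) (fun y _ hy => by
        simp only [decide_eq_true_eq] at hy ⊢; exact hy.trans hij) hx
        (by simpa using hxm.1) (by simpa using hlt)
    omega
  · have : xs.countP (· ≤ i) < xs.countP (· ≤ x) :=
      countP_lt_countP (x := x) (fun y _ hy => by
        simp only [decide_eq_true_eq] at hy ⊢; exact hy.trans hij.le) hx
        (by simpa using hij) (by simp)
    omega

/-- Every interval of weight more than `τ` contains a point of `xs`. -/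
def Covers (τ : ℝ) (μ : PMF (Fin n)) (xs : List (Fin n)) : Prop :=
  ∀ a b, τ < mass μ (Finset.Icc a b) → ∃ x ∈ xs, x ∈ Finset.Icc a b

/-- The interval spanned by a class with at least two points contains no sample, hence is not heavy.
A singleton class may be a heavy point. -/
theorem Covers.mass_class_le {τ : ℝ} {μ : PMF (Fin n)} {xs : List (Fin n)} (h : Covers τ μ xs)
    {i j : Fin n} (hne : i ≠ j) (hij : fineLabel xs i = fineLabel xs j) :
    mass μ {l | fineLabel xs l = fineLabel xs i} ≤ τ := by
  classical
  set F : Finset (Fin n) := {l | fineLabel xs l = fineLabel xs i} with hF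
  have hi : i ∈ F := by simp [hF]
  have hj : j ∈ F := by simp [hF, hij]
  have hmem : ∀ {l}, l ∈ F → fineLabel xs l = fineLabel xs i := fun hl => (Finset.mem_filter.1 hl).2
  have hlt : F.min' ⟨i, hi⟩ < F.max' ⟨i, hi⟩ := by
    rcases lt_or_gt_of_ne hne with h | h
    · exact (F.min'_le i hi).trans_lt (h.trans_le (F.le_max' j hj))
    · exact (F.min'_le j hj).trans_lt (h.trans_le (F.le_max' i hi))
  by_contra hc
  obtain ⟨x, hx, hxm⟩ := h (F.min' ⟨i, hi⟩) (F.max' ⟨i, hi⟩) ((not_le.1 hc).trans_le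
    (mass_mono μ fun l hl => Finset.mem_Icc.2 ⟨F.min'_le l hl, F.le_max' l hl⟩))
  exact notMem_of_fineLabel_eq hlt
    ((hmem (F.min'_mem _)).trans (hmem (F.max'_mem _)).symm) hx hxm

end FineLabel

/-! ### Classes that cross the boundaries of an interval partition -/

section Crossing

variable {n : ℕ}

theorem IntervalPartition.index_unique (𝓘 : IntervalPartition n) {i : Fin n} {j j' : Fin 𝓘.len}
    (h : i ∈ 𝓘.part j) (h' : i ∈ 𝓘.part j') : j = j' := by
  rcases lt_trichotomy j j' with hlt | heq | hlt
  · exact absurd (𝓘.ordered _ _ hlt _ h _ h') (lt_irrefl _)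
  · exact heq
  · exact absurd (𝓘.ordered _ _ hlt _ h' _ h) (lt_irrefl _)

open Classical in
/-- The points whose class contains a point of another interval of the partition. -/
def crossing (𝓘 : IntervalPartition n) (xs : List (Fin n)) : Finset (Fin n) :=
  {i | ∃ i', fineLabel xs i' = fineLabel xs i ∧ ∀ j, i ∈ 𝓘.part j → i' ∉ 𝓘.part j}

theorem mem_crossing {𝓘 : IntervalPartition n} {xs : List (Fin n)} {i : Fin n} :
    i ∈ crossing 𝓘 xs ↔
      ∃ i', fineLabel xs i' = fineLabel xs i ∧ ∀ j, i ∈ 𝓘.part j → i' ∉ 𝓘.part j := by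
  simp [crossing]

theorem mem_crossing_of_fineLabel_eq {𝓘 : IntervalPartition n} {xs : List (Fin n)} {i l : Fin n}
    (h : fineLabel xs i = fineLabel xs l) (hi : i ∈ crossing 𝓘 xs) : l ∈ crossing 𝓘 xs := by
  obtain ⟨i', hi', hsep⟩ := mem_crossing.1 hi
  rw [mem_crossing]
  by_cases hil : ∀ j, l ∈ 𝓘.part j → i ∉ 𝓘.part j
  · exact ⟨i, h, hil⟩
  · push Not at hil
    obtain ⟨j, hl, hij⟩ := hil
    refine ⟨i', hi'.trans h, fun j' hl' => ?_⟩
    rw [𝓘.index_unique hl' hl]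
    exact hsep j hij

/-- If `lo < hi` share a class but not an interval, the right end of the interval of `lo` lies
between them and so in that class, by monotonicity of the labels. Each crossing class is thus
charged to a right end, and having two points it weighs at most `τ`. -/
theorem Covers.mass_crossing_le {τ : ℝ} {μ : PMF (Fin n)} {xs : List (Fin n)}
    (h : Covers τ μ xs) (hτ : 0 ≤ τ) (𝓘 : IntervalPartition n) :
    mass μ (crossing 𝓘 xs) ≤ 𝓘.len * τ := by
  classical
  choose a b hab hpart using 𝓘.isInterval
  -- `Z j` is the class of the right end of the `j`-th interval, or empty if that class is a
  -- singleton.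
  let Z : Fin 𝓘.len → Finset (Fin n) := fun j =>
    if ∃ l, b j ≠ l ∧ fineLabel xs (b j) = fineLabel xs l then
      Finset.univ.filter (fun l => fineLabel xs l = fineLabel xs (b j)) else ∅
  have hZ : ∀ j, mass μ (Z j) ≤ τ := by
    intro j
    by_cases hj : ∃ l, b j ≠ l ∧ fineLabel xs (b j) = fineLabel xs l
    · obtain ⟨l, hne, hl⟩ := id hj
      simp only [Z, if_pos hj]
      exact h.mass_class_le hne hl
    · simp only [Z, if_neg hj]
      simpa [mass] using hτ
  have hpair : ∀ lo hi : Fin n, lo < hi → fineLabel xs lo = fineLabel xs hi →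
      (∀ j, lo ∈ 𝓘.part j → hi ∉ 𝓘.part j) →
      ∃ j, ∀ l, fineLabel xs l = fineLabel xs lo → l ∈ Z j := by
    intro lo hi hlt hlab hsep
    obtain ⟨j, hj⟩ := 𝓘.cover lo
    have hhi := hsep j hj
    rw [hpart, Finset.mem_Icc] at hj hhi
    have hb : b j < hi := by
      by_contra hc
      exact hhi ⟨hj.1.trans hlt.le, not_lt.1 hc⟩
    have hlb : fineLabel xs (b j) = fineLabel xs lo :=
      le_antisymm ((fineLabel_mono xs hb.le).trans hlab.ge) (fineLabel_mono xs hj.2)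
    refine ⟨j, fun l hl => ?_⟩
    have hex : ∃ l, b j ≠ l ∧ fineLabel xs (b j) = fineLabel xs l :=
      ⟨hi, hb.ne, hlb.trans hlab⟩
    simp only [Z, if_pos hex, Finset.mem_filter, Finset.mem_univ, true_and]
    exact hl.trans hlb.symm
  have hcov : ∀ i ∈ crossing 𝓘 xs, ∃ j, i ∈ Z j := by
    intro i hi
    obtain ⟨i', hlab, hsep⟩ := mem_crossing.1 hi
    rcases lt_trichotomy i i' with hlt | rfl | hlt
    · obtain ⟨j, hj⟩ := hpair i i' hlt hlab.symm hsep
      exact ⟨j, hj i rfl⟩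
    · obtain ⟨j, hj⟩ := 𝓘.cover i
      exact absurd hj (hsep j hj)
    · obtain ⟨j, hj⟩ := hpair i' i hlt hlab fun j h' h => hsep j h h'
      exact ⟨j, hj i hlab.symm⟩
  calc mass μ (crossing 𝓘 xs) ≤
        ∑ i ∈ crossing 𝓘 xs, ∑ j, if i ∈ Z j then (μ i).toReal else 0 := by
        refine Finset.sum_le_sum fun i hi => ?_
        obtain ⟨j, hj⟩ := hcov i hi
        refine (by rw [if_pos hj] : (μ i).toReal = if i ∈ Z j then (μ i).toReal else 0).trans_le ?_
        exact Finset.single_le_sum (f := fun j => if i ∈ Z j then (μ i).toReal else 0)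
          (fun j _ => by positivity) (Finset.mem_univ j)
    _ ≤ ∑ i, ∑ j, if i ∈ Z j then (μ i).toReal else 0 :=
        Finset.sum_le_sum_of_subset_of_nonneg (Finset.subset_univ _) fun i _ _ =>
          Finset.sum_nonneg fun j _ => by positivity
    _ = ∑ j, mass μ (Z j) := by
        rw [Finset.sum_comm]
        simp [mass]
    _ ≤ ∑ _j : Fin 𝓘.len, τ := Finset.sum_le_sum fun j _ => hZ j
    _ = 𝓘.len * τ := by simp

end Crossing

/-! ### Rearranging a distribution -/

section Rearrange

variable {n : ℕ}

theorem map_symm_apply (χ : PMF (Fin n)) (σ : Equiv.Perm (Fin n)) (i : Fin n) :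
    χ.map σ.symm i = χ (σ i) := by
  rw [PMF.map_apply, tsum_eq_single (σ i)]
  · simp
  · intro j hj
    rw [if_neg]
    rintro rfl
    exact hj (by simp)

theorem Conforms.map_symm {χ : PMF (Fin n)} {𝒜 : Atlas n} (h : Conforms χ 𝒜)
    {σ : Equiv.Perm (Fin n)}
    (hσ : ∀ i j, i ∈ 𝒜.partition.part j ↔ σ i ∈ 𝒜.partition.part j) :
    Conforms (χ.map σ.symm) 𝒜 := by
  intro j
  have e : (𝒜.partition.part j).map σ.toEmbedding = 𝒜.partition.part j := by
    ext i
    rw [Finset.mem_map_equiv, hσ, Equiv.apply_symm_apply]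
  rw [← h j, inventory, inventory]
  conv_rhs => rw [← e, Finset.map_val, Multiset.map_map]
  exact Multiset.map_congr rfl fun i _ => map_symm_apply χ σ i

theorem l1dist_triangle (μ χ ψ : PMF (Fin n)) : l1dist μ ψ ≤ l1dist μ χ + l1dist χ ψ := by
  rw [l1dist, l1dist, l1dist, ← Finset.sum_add_distrib]
  exact Finset.sum_le_sum fun i _ => abs_sub_le _ _ _

/-- The level functions of a distribution on the intervals cut out by `xs`. -/
def profile (xs : List (Fin n)) (μ : PMF (Fin n)) : LabelledL1 (Fin (2 * xs.length + 1)) :=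
  ∑ i, (μ i).toReal • atLabel (fineLabel xs i) (unitBox (μ i).toReal)

theorem norm_profile_sub (xs : List (Fin n)) (μ χ : PMF (Fin n)) :
    ‖profile xs μ - profile xs χ‖ = ∑ r,
      ‖∑ i with fineLabel xs i = r, box (μ i).toReal -
        ∑ i with fineLabel xs i = r, box (χ i).toReal‖ := by
  have e : ∀ μ : PMF (Fin n), profile xs μ = ∑ i, atLabel (fineLabel xs i) (box (μ i).toReal) :=
    fun μ => Finset.sum_congr rfl fun i _ => by rw [smul_atLabel, smul_unitBox]
  rw [PiLp.norm_eq_of_L1]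
  refine Finset.sum_congr rfl fun r _ => ?_
  rw [e, e, PiLp.sub_apply, sum_atLabel_apply, sum_atLabel_apply]

/-- The best matching within classes costs the distance of the profiles. Undoing it on crossing
classes restores conformity and adds at most their weight under `μ` and under `χ`. -/
theorem exists_conforming_l1dist_le {τ : ℝ} (hτ : 0 ≤ τ) {xs : List (Fin n)} {μ χ : PMF (Fin n)}
    (hμ : Covers τ μ xs) (hχ : Covers τ χ xs) {𝒜 : Atlas n} (h𝒜 : Conforms χ 𝒜) :
    ∃ χ' : PMF (Fin n), Conforms χ' 𝒜 ∧
      l1dist μ χ' ≤ ‖profile xs μ - profile xs χ‖ + 2 * (𝒜.length * τ) := by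
  classical
  obtain ⟨σ₀, hlab, hsum⟩ := exists_perm_sum_abs_sub_eq (fineLabel xs)
    (a := fun i => (μ i).toReal) (b := fun i => (χ i).toReal)
    (fun _ => ENNReal.toReal_nonneg) (fun _ => ENNReal.toReal_nonneg)
  rw [← norm_profile_sub] at hsum
  set X := crossing 𝒜.partition xs with hX
  have hclosed : ∀ i, (σ₀ i ∉ X) ↔ i ∉ X := fun i => not_congr
    ⟨mem_crossing_of_fineLabel_eq (hlab i), mem_crossing_of_fineLabel_eq (hlab i).symm⟩
  -- `X` is a union of classes, so `σ₀` preserves its complement; `σ` is `σ₀` there and the identity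
  -- on `X`.
  let σ : Equiv.Perm (Fin n) := Equiv.Perm.ofSubtype (σ₀.subtypePerm (p := fun i => i ∉ X) hclosed)
  have hσX : ∀ i ∈ X, σ i = i := fun i hi =>
    Equiv.Perm.ofSubtype_apply_of_not_mem _ (not_not.2 hi)
  have hσ : ∀ i, i ∉ X → σ i = σ₀ i := fun i hi => by
    simp only [σ]
    rw [Equiv.Perm.ofSubtype_apply_of_mem (p := fun i => i ∉ X) _ hi]
    rfl
  refine ⟨χ.map σ.symm, h𝒜.map_symm fun i j => ?_, ?_⟩
  · by_cases hi : i ∈ X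
    · rw [hσX i hi]
    · rw [hσ i hi]
      have hnc := mt mem_crossing.2 hi
      push Not at hnc
      obtain ⟨j', h1, h2⟩ := hnc (σ₀ i) (hlab i)
      constructor
      · intro h; rwa [𝒜.partition.index_unique h h1]
      · intro h; rwa [𝒜.partition.index_unique h h2]
  · have hpt : ∀ i, |(μ i).toReal - (χ.map σ.symm i).toReal| ≤
        |(μ i).toReal - (χ (σ₀ i)).toReal| +
          if i ∈ X then (μ i).toReal + (χ i).toReal else 0 := by
      intro i
      rw [map_symm_apply]
      by_cases hi : i ∈ X
      · rw [hσX i hi, if_pos hi]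
        have h1 : 0 ≤ (μ i).toReal := ENNReal.toReal_nonneg
        have h2 : 0 ≤ (χ i).toReal := ENNReal.toReal_nonneg
        have h3 := abs_nonneg ((μ i).toReal - (χ (σ₀ i)).toReal)
        have h4 : |(μ i).toReal - (χ i).toReal| ≤ (μ i).toReal + (χ i).toReal :=
          abs_le.2 ⟨by linarith, by linarith⟩
        linarith
      · rw [hσ i hi, if_neg hi, add_zero]
    calc l1dist μ (χ.map σ.symm) ≤ _ := Finset.sum_le_sum fun i _ => hpt i
      _ = ‖profile xs μ - profile xs χ‖ + (mass μ X + mass χ X) := by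
          rw [Finset.sum_add_distrib, hsum, ← Finset.sum_filter, Finset.filter_mem_eq_inter,
            Finset.univ_inter, Finset.sum_add_distrib, mass, mass]
      _ ≤ _ := by
          have h1 := hμ.mass_crossing_le hτ 𝒜.partition
          have h2 := hχ.mass_crossing_le hτ 𝒜.partition
          rw [Atlas.length]
          linarith

/-- The samples `xs` and the weighted samples `ys` are representative of `μ`. -/
def Representative (τ η : ℝ) (s : ℕ) (μ : PMF (Fin n))
    (ω : List (Fin n) × List (Fin n × ℝ)) : Prop :=
  Covers τ μ ω.1 ∧
    ‖(s : ℝ)⁻¹ • (ω.2.map fun a => atLabel (fineLabel ω.1 a.1) (unitBox a.2)).sum -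
      profile ω.1 μ‖ ≤ η

theorem exists_conforming_of_representative {τ η : ℝ} (hτ : 0 ≤ τ) {s : ℕ}
    {ω : List (Fin n) × List (Fin n × ℝ)} {μ χ : PMF (Fin n)}
    (hμ : Representative τ η s μ ω) (hχ : Representative τ η s χ ω) {𝒜 : Atlas n}
    (h𝒜 : Conforms χ 𝒜) :
    ∃ χ' : PMF (Fin n), Conforms χ' 𝒜 ∧ l1dist μ χ' ≤ 2 * η + 2 * (𝒜.length * τ) := by
  obtain ⟨χ', h1, h2⟩ := exists_conforming_l1dist_le hτ hμ.1 hχ.1 h𝒜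
  refine ⟨χ', h1, h2.trans ?_⟩
  have h3 := norm_sub_le_norm_sub_add_norm_sub (profile ω.1 μ)
    ((s : ℝ)⁻¹ • (ω.2.map fun a => atLabel (fineLabel ω.1 a.1) (unitBox a.2)).sum) (profile ω.1 χ)
  rw [norm_sub_rev (profile ω.1 μ) (_ • _)] at h3
  linarith [hμ.2, hχ.2]

end Rearrange

/-! ### Rounding weights to a geometric scale -/

section Bucket

open Classical in
/-- The position of `v` among the powers of `1 - 1 / d` with exponents up to `B`. -/
def bucket (d B : ℕ) (v : ℝ) : Fin (B + 1) :=
  ⟨Nat.findGreatest (fun b => v ≤ (1 - 1 / (d : ℝ)) ^ b) B, Nat.lt_succ_of_le (Nat.findGreatest_le B)⟩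

theorem le_pow_bucket (d B : ℕ) {v : ℝ} (hv : v ≤ 1) :
    v ≤ (1 - 1 / (d : ℝ)) ^ (bucket d B v : ℕ) := by
  classical
  exact Nat.findGreatest_spec (P := fun b => v ≤ (1 - 1 / (d : ℝ)) ^ b) (m := 0) (Nat.zero_le _)
    (by simpa using hv)

theorem lt_of_pow_lt (d B : ℕ) {v : ℝ} (hv : v ≤ 1) (hB : (1 - 1 / (d : ℝ)) ^ B < v) :
    (1 - 1 / (d : ℝ)) ^ ((bucket d B v : ℕ) + 1) < v := by
  classical
  by_contra hc
  have hne : (bucket d B v : ℕ) ≠ B := fun h => by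
    have := le_pow_bucket d B hv
    rw [h] at this
    linarith
  have hlt : (bucket d B v : ℕ) < B := lt_of_le_of_ne (Nat.lt_succ_iff.1 (bucket d B v).2) hne
  exact Nat.findGreatest_is_greatest (P := fun b => v ≤ (1 - 1 / (d : ℝ)) ^ b)
    (Nat.lt_succ_self _) hlt (not_lt.1 hc)

theorem norm_unitBox_bucket_sub_le {d B : ℕ} (hd : 1 < d) {v : ℝ} (hv : v ≤ 1)
    (hB : (1 - 1 / (d : ℝ)) ^ B < v) :
    ‖unitBox ((1 - 1 / (d : ℝ)) ^ (bucket d B v : ℕ)) - unitBox v‖ ≤ 2 / d := by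
  have hd' : (1 : ℝ) < d := by exact_mod_cast hd
  have hρ : 0 < 1 - 1 / (d : ℝ) := by
    rw [sub_pos, div_lt_one (by linarith)]; exact hd'
  have hρ1 : 1 - 1 / (d : ℝ) ≤ 1 := by
    have : 0 ≤ 1 / (d : ℝ) := by positivity
    linarith
  have hv0 : 0 < v := (pow_pos hρ B).trans hB
  have h1 := le_pow_bucket d B hv
  have h2 := lt_of_pow_lt d B hv hB
  rw [pow_succ'] at h2
  refine (norm_unitBox_sub_le (δ := 1 / d) (pow_pos hρ _) hv0 ⟨h2.le, ?_⟩).trans (le_of_eq (by ring))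
  exact (mul_le_of_le_one_left hv0.le hρ1).trans h1

/-- The left side is at most `exp (-h) * exp (-d)`, with `exp h ≥ 2 ^ h > n` and `exp d ≥ d`. So `d
* (h + d)` scales reach below every weight that is not negligible. -/
theorem pow_le_one_div {n h d : ℕ} (hd : 1 < d) (hn0 : 0 < n) (hn : n < 2 ^ h) :
    (1 - 1 / (d : ℝ)) ^ (d * (h + d)) ≤ 1 / (d * n) := by
  have hd' : (1 : ℝ) < d := by exact_mod_cast hd
  have hn' : (0 : ℝ) < n := by exact_mod_cast hn0
  have hρ : 0 < 1 - 1 / (d : ℝ) := by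
    rw [sub_pos, div_lt_one (by linarith)]; exact hd'
  have h1 : 1 - 1 / (d : ℝ) ≤ Real.exp (-(1 / d)) := by
    have := Real.add_one_le_exp (-(1 / (d : ℝ)))
    linarith
  have h2 : (1 - 1 / (d : ℝ)) ^ (d * (h + d)) ≤ Real.exp (-(h + d)) := by
    refine (pow_le_pow_left₀ hρ.le h1 _).trans (le_of_eq ?_)
    rw [← Real.exp_nat_mul]
    congr 1
    push_cast
    field_simp
  refine h2.trans ?_
  rw [Real.exp_neg, inv_eq_one_div]
  apply one_div_le_one_div_of_le (by positivity)
  rw [Real.exp_add, mul_comm]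
  refine mul_le_mul ?_ ?_ (by linarith) (Real.exp_pos _).le
  · have h3 : (n : ℝ) ≤ 2 ^ h := by exact_mod_cast hn.le
    refine h3.trans ?_
    rw [← mul_one (h : ℝ), Real.exp_nat_mul]
    refine pow_le_pow_left₀ (by norm_num) ?_ _
    have := Real.add_one_le_exp 1
    linarith
  · have := Real.add_one_le_exp (d : ℝ)
    linarith

theorem apply_toReal_le_one {n : ℕ} (μ : PMF (Fin n)) (i : Fin n) : (μ i).toReal ≤ 1 := by
  simpa using ENNReal.toReal_mono ENNReal.one_ne_top (μ.coe_le_one i)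

/-- Points of weight at most `1 / (d * n)` weigh at most `1 / d` together and cost at most 2 each;
all others are rounded with error at most `2 / d`. -/
theorem expect_bucket_le {n h d : ℕ} (hd : 1 < d) (hn : n < 2 ^ h) (μ : PMF (Fin n)) :
    expect μ (fun i =>
      ‖unitBox ((1 - 1 / (d : ℝ)) ^ (bucket d (d * (h + d)) (μ i).toReal : ℕ)) -
        unitBox (μ i).toReal‖ₑ) ≤ ENNReal.ofReal (4 / d) := by
  classical
  have hd' : (1 : ℝ) < d := by exact_mod_cast hd
  have hn0 : 0 < n := by
    obtain ⟨i, -⟩ := μ.support_nonempty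
    exact i.pos
  have hn' : (0 : ℝ) < n := by exact_mod_cast hn0
  have hsmall : prob μ {i | (μ i).toReal ≤ 1 / (d * n)} ≤ ENNReal.ofReal (1 / d) := by
    rw [prob_eq_ofReal_mass]
    apply ENNReal.ofReal_le_ofReal
    rw [mass]
    refine (Finset.sum_le_card_nsmul _ _ (1 / (d * n : ℝ)) fun i hi => ?_).trans ?_
    · simpa using hi
    · rw [nsmul_eq_mul]
      have hc : ((Finset.univ.filter fun i => i ∈ {i : Fin n | (μ i).toReal ≤ 1 / (d * n)}).card : ℝ)
          ≤ n := by
        exact_mod_cast (Finset.card_le_univ _).trans (Fintype.card_fin n).le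
      calc _ ≤ (n : ℝ) * (1 / (d * n)) := mul_le_mul_of_nonneg_right hc (by positivity)
        _ = 1 / d := by field_simp
  have hbound : ∀ i, ‖unitBox ((1 - 1 / (d : ℝ)) ^ (bucket d (d * (h + d)) (μ i).toReal : ℕ)) -
      unitBox (μ i).toReal‖ₑ ≤ ENNReal.ofReal 2 := fun i => by
    rw [← ofReal_norm]
    exact ENNReal.ofReal_le_ofReal (norm_unitBox_sub_le_two _ _)
  have hclose : ∀ i, μ i ≠ 0 → i ∉ {i | (μ i).toReal ≤ 1 / (d * n)} →
      ‖unitBox ((1 - 1 / (d : ℝ)) ^ (bucket d (d * (h + d)) (μ i).toReal : ℕ)) -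
        unitBox (μ i).toReal‖ₑ ≤ ENNReal.ofReal (2 / d) := fun i _ hi => by
    rw [← ofReal_norm]
    exact ENNReal.ofReal_le_ofReal (norm_unitBox_bucket_sub_le hd (apply_toReal_le_one μ i)
      ((pow_le_one_div hd hn0 hn).trans_lt (not_le.1 hi)))
  refine (expect_le_mul_add hbound hclose).trans
    ((add_le_add_left (mul_le_mul_right hsmall _) _).trans ?_)
  rw [← ENNReal.ofReal_mul (by norm_num), ← ENNReal.ofReal_add (by positivity) (by positivity)]
  exact ENNReal.ofReal_le_ofReal (le_of_eq (by ring))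

end Bucket

/-! ### Typical samples are representative -/

section Typical

variable {n : ℕ}

theorem expect_weightedSample_fst (m h : ℕ) (μ : PMF (Fin n)) (f : Fin n → ℝ≥0∞) :
    expect (weightedSample m h μ) (fun a => f a.1) = expect μ f := by
  rw [weightedSample, expect_bind]
  congr 1
  ext y
  rw [expect_map]
  exact expect_const _ (f y)

theorem prob_weightedSample_fst (m h : ℕ) (μ : PMF (Fin n)) (S : Set (Fin n)) :
    prob (weightedSample m h μ) {a | a.1 ∈ S} = prob μ S :=
  expect_weightedSample_fst m h μ (S.indicator 1)

theorem expect_profile_error_le {m h d s : ℕ} (hh : 0 < h) (hd : 1 < d) (hn : n < 2 ^ h)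
    (hm : m = 2 * h ^ 4 * d ^ 4) (μ : PMF (Fin n)) (xs : List (Fin n))
    (hs : s = (2 * xs.length + 1) * (d * (h + d) + 1) * d ^ 2) :
    expect (iid (weightedSample m h μ) s) (fun ys =>
      ‖(s : ℝ)⁻¹ • (ys.map fun a => atLabel (fineLabel xs a.1) (unitBox a.2)).sum -
        profile xs μ‖ₑ) ≤ ENNReal.ofReal (15 / d) := by
  classical
  set B := d * (h + d) with hB
  let cell : Fin n → Fin (2 * xs.length + 1) × Fin (B + 1) :=
    fun y => (fineLabel xs y, bucket d B (μ y).toReal)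
  let Ψ : Fin (2 * xs.length + 1) × Fin (B + 1) → LabelledL1 (Fin (2 * xs.length + 1)) :=
    fun r => atLabel r.1 (unitBox ((1 - 1 / (d : ℝ)) ^ (r.2 : ℕ)))
  let P : Fin (2 * xs.length + 1) × Fin (B + 1) → ℝ := fun r => mass μ {y | cell y = r}
  have hd0 : (0 : ℝ) < d := by exact_mod_cast (zero_lt_one.trans hd)
  have hΨ : ∀ r, ‖Ψ r‖ ≤ 1 := fun r => (norm_atLabel _ _).trans_le (norm_unitBox_le _)
  have hP : ∀ r, ENNReal.ofReal (P r) =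
      prob (weightedSample m h μ) {a : Fin n × ℝ | cell a.1 = r} := fun r => by
    refine Eq.trans ?_ (prob_weightedSample_fst m h μ {y | cell y = r}).symm
    rw [prob_eq_ofReal_mass]
    rfl
  have hP1 : ∑ r, P r = 1 := by
    rw [← mass_univ μ]
    exact Finset.sum_fiberwise_of_maps_to (fun _ _ => Finset.mem_univ _) _
  have hmain := expect_enorm_average_sub_le (weightedSample m h μ)
    (c := fun a : Fin n × ℝ => cell a.1)
    (fun a : Fin n × ℝ => atLabel (fineLabel xs a.1) (unitBox a.2)) hΨ hP
    (fun r => mass_nonneg μ _) hP1 (d := d) (s := s) (zero_lt_one.trans hd)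
    (by rw [hs, Fintype.card_prod, Fintype.card_fin, Fintype.card_fin])
  have hbucket := expect_bucket_le hd hn μ
  rw [← hB] at hbucket
  have hPΨ : ∑ r, P r • Ψ r = ∑ y, (μ y).toReal • Ψ (cell y) := by
    rw [← Finset.sum_fiberwise_of_maps_to (g := cell) (t := Finset.univ)
      (fun _ _ => Finset.mem_univ _)]
    refine Finset.sum_congr rfl fun r _ => ?_
    rw [show P r = ∑ y with cell y = r, (μ y).toReal from rfl, Finset.sum_smul]
    refine Finset.sum_congr rfl fun y hy => ?_
    rw [(Finset.mem_filter.1 hy).2]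
  have henorm : ∀ (r : Fin (2 * xs.length + 1)) (f : ℝ →₁[volume] ℝ), ‖atLabel r f‖ₑ = ‖f‖ₑ :=
    fun r f => by rw [← ofReal_norm, ← ofReal_norm, norm_atLabel]
  have hround : ‖∑ r, P r • Ψ r - profile xs μ‖ₑ ≤ ENNReal.ofReal (4 / d) := by
    refine le_trans ?_ hbucket
    rw [hPΨ, profile, ← Finset.sum_sub_distrib, expect_fintype]
    refine (enorm_sum_le _ _).trans (Finset.sum_le_sum fun y _ => ?_)
    rw [← smul_sub, ← atLabel_sub, enorm_smul, henorm, Real.enorm_eq_ofReal ENNReal.toReal_nonneg,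
      ENNReal.ofReal_toReal (μ.apply_ne_top y)]
  have hvec : expect (weightedSample m h μ) (fun a : Fin n × ℝ =>
      ‖atLabel (fineLabel xs a.1) (unitBox a.2) - Ψ (cell a.1)‖ₑ) ≤
      ENNReal.ofReal (6 / d) + ENNReal.ofReal (4 / d) := by
    refine le_trans ?_ (add_le_add (expect_weightedSample_unitBox_le hh hd hn hm μ)
      ((expect_weightedSample_fst m h μ _).trans_le hbucket))
    rw [← expect_add]
    refine expect_mono fun a => ?_
    rw [← atLabel_sub, henorm, ← sub_add_sub_cancel _ (unitBox (μ a.1).toReal)]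
    refine (enorm_add_le _ _).trans (add_le_add le_rfl (le_of_eq ?_))
    rw [← ofReal_norm, norm_sub_rev, ofReal_norm]
  calc _ ≤ expect (iid (weightedSample m h μ) s) (fun ys =>
        ‖(s : ℝ)⁻¹ • (ys.map fun a => atLabel (fineLabel xs a.1) (unitBox a.2)).sum -
          ∑ r, P r • Ψ r‖ₑ + ENNReal.ofReal (4 / d)) := by
        refine expect_mono fun ys => ?_
        rw [← sub_add_sub_cancel _ (∑ r, P r • Ψ r)]
        exact (enorm_add_le _ _).trans (add_le_add le_rfl hround)
    -- The terms are the error of the weight estimates, the rounding of the sampled vectors, the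
    -- fluctuation of the cell counts, and the rounding of the mean.
    _ ≤ (ENNReal.ofReal (6 / d) + ENNReal.ofReal (4 / d)) + ENNReal.ofReal (1 / d) +
          ENNReal.ofReal (4 / d) := by
        rw [expect_add, expect_const]
        exact add_le_add (hmain.trans (add_le_add hvec le_rfl)) le_rfl
    _ = ENNReal.ofReal (15 / d) := by
        rw [← ENNReal.ofReal_add (by positivity) (by positivity),
          ← ENNReal.ofReal_add (by positivity) (by positivity),
          ← ENNReal.ofReal_add (by positivity) (by positivity)]
        congr 1
        ring

/-- A heavy interval is missed with probability at most `exp (-τ * t)`. There are at most `n² ≤ exp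
(2h)` intervals, and the remaining `exp (-2)` is below 1/6. -/
theorem prob_not_covers_le {h t : ℕ} {τ : ℝ} (hn : n < 2 ^ h)
    (ht : 2 * h + 2 ≤ τ * t) (μ : PMF (Fin n)) :
    prob (iid μ t) {xs | ¬ Covers τ μ xs} ≤ ENNReal.ofReal (1 / 6) := by
  have hmiss : ∀ ab : Fin n × Fin n, prob (iid μ t) {xs | τ < mass μ (Finset.Icc ab.1 ab.2) ∧
      ∀ x ∈ xs, x ∉ (Finset.Icc ab.1 ab.2 : Set (Fin n))} ≤
      ENNReal.ofReal (Real.exp (-(2 * h + 2))) := by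
    intro ab
    by_cases hab : τ < mass μ (Finset.Icc ab.1 ab.2)
    · refine (prob_mono fun xs hxs => hxs.2).trans ((prob_iid_forall_notMem μ _ t).trans_le ?_)
      have hp : prob μ (Finset.Icc ab.1 ab.2 : Set (Fin n)) =
          ENNReal.ofReal (mass μ (Finset.Icc ab.1 ab.2)) := by
        classical
        rw [prob_eq_ofReal_mass]
        congr 2
        ext i
        simp
      have h1 : mass μ (Finset.Icc ab.1 ab.2) ≤ 1 :=
        (mass_mono μ (Finset.subset_univ _)).trans (mass_univ μ).le
      rw [hp, ← ENNReal.ofReal_one, ← ENNReal.ofReal_sub _ (mass_nonneg μ _),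
        ← ENNReal.ofReal_pow (by linarith)]
      apply ENNReal.ofReal_le_ofReal
      calc (1 - mass μ (Finset.Icc ab.1 ab.2)) ^ t ≤ Real.exp (-τ) ^ t := by
            refine pow_le_pow_left₀ (by linarith) ?_ t
            have := Real.add_one_le_exp (-τ)
            linarith
        _ ≤ Real.exp (-(2 * h + 2)) := by
            rw [← Real.exp_nat_mul]
            apply Real.exp_le_exp.2
            linarith
    · refine le_of_eq_of_le ?_ zero_le
      simp [hab, prob, expect]
  calc prob (iid μ t) {xs | ¬ Covers τ μ xs} ≤ prob (iid μ t) (⋃ ab : Fin n × Fin n,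
        {xs | τ < mass μ (Finset.Icc ab.1 ab.2) ∧
          ∀ x ∈ xs, x ∉ (Finset.Icc ab.1 ab.2 : Set (Fin n))}) := by
        refine prob_mono fun xs hxs => ?_
        simp only [Covers, Set.mem_ofPred_eq] at hxs
        push Not at hxs
        obtain ⟨a, b, h1, h2⟩ := hxs
        exact Set.mem_iUnion.2 ⟨(a, b), h1, fun x hx => by simpa using h2 x hx⟩
    _ ≤ ∑ _ab : Fin n × Fin n, ENNReal.ofReal (Real.exp (-(2 * h + 2))) :=
        (prob_iUnion_le _ _).trans (Finset.sum_le_sum fun ab _ => hmiss ab)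
    _ = ENNReal.ofReal (n * n * Real.exp (-(2 * h + 2))) := by
        rw [Finset.sum_const, Finset.card_univ, Fintype.card_prod, Fintype.card_fin, nsmul_eq_mul,
          ← ENNReal.ofReal_natCast, ← ENNReal.ofReal_mul (by positivity)]
        push_cast
        rfl
    _ ≤ ENNReal.ofReal (1 / 6) := by
        apply ENNReal.ofReal_le_ofReal
        have hnh : (n : ℝ) ≤ Real.exp h := by
          have h3 : (n : ℝ) ≤ 2 ^ h := by exact_mod_cast hn.le
          refine h3.trans ?_
          rw [← mul_one (h : ℝ), Real.exp_nat_mul]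
          refine pow_le_pow_left₀ (by norm_num) ?_ _
          have := Real.add_one_le_exp 1
          linarith
        have he : Real.exp (-(2 * h + 2)) = (Real.exp h * Real.exp h * (Real.exp 1 * Real.exp 1))⁻¹ := by
          rw [← Real.exp_add, ← Real.exp_add, ← Real.exp_add, ← Real.exp_neg]
          congr 1
          ring
        have h6 : 6 ≤ Real.exp 1 * Real.exp 1 := by nlinarith [Real.exp_one_gt_d9]
        rw [he, ← div_eq_mul_inv, div_le_div_iff₀ (by positivity) (by norm_num), one_mul]
        exact mul_le_mul (mul_le_mul hnh hnh (Nat.cast_nonneg n) (Real.exp_pos _).le) h6 (by norm_num)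
          (by positivity)

theorem length_eq_of_iid_ne_zero {α : Type} {p : PMF α} {s : ℕ} {l : List α}
    (h : iid p s l ≠ 0) : l.length = s := by
  induction s generalizing l with
  | zero =>
    have : l ∈ (PMF.pure ([] : List α)).support := (PMF.mem_support_iff _ _).2 h
    rw [PMF.support_pure, Set.mem_singleton_iff] at this
    rw [this, List.length_nil]
  | succ s ih =>
    have : l ∈ (p.bind fun a => (iid p s).map (a :: ·)).support := (PMF.mem_support_iff _ _).2 h
    simp only [PMF.support_bind, PMF.support_map, Set.mem_iUnion, Set.mem_image] at this
    obtain ⟨a, -, l', hl', rfl⟩ := this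
    rw [List.length_cons, ih ((PMF.mem_support_iff _ _).1 hl')]

/-- The joint law of `t` plain samples and `s` weighted samples. -/
def sampleLaw (t s m h : ℕ) (μ : PMF (Fin n)) : PMF (List (Fin n) × List (Fin n × ℝ)) :=
  (iid μ t).bind fun xs => (iid (weightedSample m h μ) s).map fun ys => (xs, ys)

/-- Missing a heavy interval costs 1/6. Since `d = 450 * E`, the mean profile error `15 / d` is one
sixth of the tolerance `1 / (5 * E)`, so Markov costs another 1/6. -/
theorem prob_not_representative_le {m h d s t E : ℕ} {τ : ℝ} (hh : 0 < h) (hE : 0 < E)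
    (hd : d = 450 * E) (hn : n < 2 ^ h) (hm : m = 2 * h ^ 4 * d ^ 4) (ht : 2 * h + 2 ≤ τ * t) (hs : s = (2 * t + 1) * (d * (h + d) + 1) * d ^ 2)
    (μ : PMF (Fin n)) :
    prob (sampleLaw t s m h μ) {ω | ¬ Representative τ (1 / (5 * E)) s μ ω} ≤
      ENNReal.ofReal (1 / 3) := by
  have hd1 : 1 < d := by omega
  have hE' : (0 : ℝ) < E := by exact_mod_cast hE
  refine (prob_bind_le (T := {xs | ¬ Covers τ μ xs}) (c := ENNReal.ofReal (1 / 6))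
    fun xs hxs hcov => ?_).trans ((add_le_add_left (prob_not_covers_le hn ht μ) _).trans ?_)
  · simp only [Set.mem_ofPred_eq, not_not] at hcov
    rw [prob_map]
    have hlen := length_eq_of_iid_ne_zero hxs
    set F : List (Fin n × ℝ) → LabelledL1 (Fin (2 * xs.length + 1)) := fun ys =>
      (s : ℝ)⁻¹ • (ys.map fun a => atLabel (fineLabel xs a.1) (unitBox a.2)).sum - profile xs μ
    have hexp : expect (iid (weightedSample m h μ) s) (fun ys => ‖F ys‖ₑ) ≤
        ENNReal.ofReal (15 / d) :=
      expect_profile_error_le hh hd1 hn hm μ xs (by rw [hs, hlen])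
    have hsub : ((fun ys => (xs, ys)) ⁻¹' {ω | ¬ Representative τ (1 / (5 * E)) s μ ω}) ⊆
        {ys | ENNReal.ofReal (1 / (5 * E)) ≤ ‖F ys‖ₑ} := by
      intro ys hys
      have hnot : ¬ ‖F ys‖ ≤ 1 / (5 * E) := fun hle => hys ⟨hcov, hle⟩
      simp only [Set.mem_ofPred_eq]
      rw [← ofReal_norm]
      exact ENNReal.ofReal_le_ofReal (not_le.1 hnot).le
    have hmarkov := (mul_prob_le_expect (iid (weightedSample m h μ) s) (fun ys => ‖F ys‖ₑ)
      (ENNReal.ofReal (1 / (5 * E)))).trans hexp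
    refine (prob_mono hsub).trans ?_
    have hη : (0 : ℝ) < 1 / (5 * E) := by positivity
    rw [mul_comm, ← ENNReal.le_div_iff_mul_le (by simp [hE]) (by simp),
      ← ENNReal.ofReal_div_of_pos hη] at hmarkov
    refine hmarkov.trans (ENNReal.ofReal_le_ofReal (le_of_eq ?_))
    rw [hd]
    push_cast
    field_simp
    norm_num
  · rw [← ENNReal.ofReal_add (by norm_num) (by norm_num)]
    exact ENNReal.ofReal_le_ofReal (by norm_num)

theorem implementable_sampleLaw (t s m h : ℕ) (hn : 0 < n) :
    Implementable (n := n) (t + s * (1 + h * m)) (sampleLaw t s m h) := by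
  have huniv : (Finset.univ : Finset (Fin n)).Nonempty := ⟨⟨0, hn⟩, Finset.mem_univ _⟩
  have hid : Implementable (n := n) 1 fun μ => μ := by
    simpa only [condOracle_univ] using Implementable.oracle huniv
  have hw : Implementable (n := n) (1 + h * m) (weightedSample m h) :=
    hid.bind fun y => (implementable_estimate m y h).map _
  have hx : Implementable (n := n) t fun μ => iid μ t := by simpa only [mul_one] using hid.iid t
  exact hx.bind fun xs => (hw.iid s).map _

end Typical

/-! ### The tester -/

section Tester

variable {n : ℕ}

/-- The outcome is accepted iff it is good for some member of `C`. Only queries are counted, so this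
decision may be an arbitrary function of the outcome. -/
theorem exists_tester_of_rejection_le {q : ℕ} {C : Set (PMF (Fin n))} {ε : ℝ} {Ω : Type}
    {law : PMF (Fin n) → PMF Ω} (hlaw : Implementable q law) (good : PMF (Fin n) → Set Ω)
    (hgood : ∀ μ, prob (law μ) {ω | ω ∉ good μ} ≤ ENNReal.ofReal (1 / 3))
    (hsound : ∀ μ, ∀ χ ∈ C, ∀ ω ∈ good μ, ω ∈ good χ → ¬ IsFar ε μ C) :
    ∃ T : CondAlgorithm n Bool q, IsConditionalTester C ε (1 / 3) T := by
  classical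
  obtain ⟨T, hT⟩ := hlaw.map fun ω => decide (∃ χ ∈ C, ω ∈ good χ)
  have hsum : ∀ μ, ((T.run μ) true).toReal + ((T.run μ) false).toReal = 1 := by
    intro μ
    have h := (T.run μ).tsum_coe
    rw [tsum_fintype, Fintype.sum_bool] at h
    rw [← ENNReal.toReal_add ((T.run μ).apply_ne_top _) ((T.run μ).apply_ne_top _), h,
      ENNReal.toReal_one]
  have hle : ∀ μ b, (∀ ω ∈ good μ, decide (∃ χ ∈ C, ω ∈ good χ) ≠ b) →
      ((T.run μ) b).toReal ≤ 1 / 3 := by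
    intro μ b hb
    refine ENNReal.toReal_le_of_le_ofReal (by norm_num) ?_
    rw [← prob_singleton, hT, prob_map]
    refine (prob_mono fun ω hω hg => hb ω hg hω).trans (hgood μ)
  refine ⟨T, fun μ hμ => ?_, fun μ hμ => ?_⟩
  · have h1 := hle μ false fun ω hω => by
      rw [decide_eq_true (⟨μ, hμ, hω⟩ : ∃ χ ∈ C, ω ∈ good χ)]
      simp
    linarith [hsum μ]
  · have h1 := hle μ true fun ω hω hacc => by
      obtain ⟨χ, hχ, hg⟩ := of_decide_eq_true hacc
      exact hsound μ χ hχ ω hω hg hμ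
    linarith [hsum μ]

/-- The distance budget is `2ε/5` for the two profile errors, `2ε/5` for the crossing classes under
both distributions, and `ε/5` for the characterization by atlases. -/
theorem not_isFar_of_conforming {ε : ℝ} {E K : ℕ} (hE : 0 < E) (hK : 0 < K)
    (hεE : 1 / ε ≤ E) (hε : 0 < ε) {C : Set (PMF (Fin n))} {s : ℕ}
    {ω : List (Fin n) × List (Fin n × ℝ)} {μ χ : PMF (Fin n)}
    (hμ : Representative (1 / (5 * E * K)) (1 / (5 * E)) s μ ω)
    (hχ : Representative (1 / (5 * E * K)) (1 / (5 * E)) s χ ω) {𝒜 : Atlas n}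
    (h𝒜 : Conforms χ 𝒜) (hlen : 𝒜.length ≤ K)
    (hclose : ∀ χ' : PMF (Fin n), Conforms χ' 𝒜 → ¬ IsFar (ε / 5) χ' C) : ¬ IsFar ε μ C := by
  have hE' : (0 : ℝ) < E := by exact_mod_cast hE
  have hK' : (0 : ℝ) < K := by exact_mod_cast hK
  obtain ⟨χ', h1, h2⟩ := exists_conforming_of_representative (by positivity) hμ hχ h𝒜
  have h3 := hclose χ' h1
  simp only [IsFar] at h3 ⊢
  push Not at h3 ⊢
  obtain ⟨ψ, hψ, h4⟩ := h3
  refine ⟨ψ, hψ, (l1dist_triangle μ χ' ψ).trans ?_⟩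
  have h5 : (𝒜.length : ℝ) * (1 / (5 * E * K)) ≤ 1 / (5 * E) := by
    have hl : (𝒜.length : ℝ) ≤ K := by exact_mod_cast hlen
    calc (𝒜.length : ℝ) * (1 / (5 * E * K)) ≤ K * (1 / (5 * E * K)) := by gcongr
      _ = 1 / (5 * E) := by field_simp
  have h6 : 1 / (5 * (E : ℝ)) ≤ ε / 5 := by
    rw [div_le_iff₀ hε] at hεE
    rw [div_le_div_iff₀ (by positivity) (by norm_num)]
    nlinarith
  linarith

end Tester

/-! ### Arithmetic of the query bound. -/

theorem query_count_le {h E K d m t s : ℕ} (hh : 0 < h) (hE : 0 < E) (hK : 0 < K)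
    (hd : d = 450 * E) (hm : m = 2 * h ^ 4 * d ^ 4) (ht : t = 10 * E * K * (h + 1))
    (hs : s = (2 * t + 1) * (d * (h + d) + 1) * d ^ 2) :
    t + s * (1 + h * m) ≤ K * (389 * 450 ^ 8 * h ^ 7 * E ^ 9) := by
  have hd0 : 0 < d := by omega
  have hEK : 1 ≤ E * K * h := Nat.succ_le_of_lt (by positivity)
  have hhd : 1 ≤ h * d ^ 2 := Nat.succ_le_of_lt (by positivity)
  have h1 : t ≤ 20 * (E * K * h) := by
    rw [ht]
    have : E * K ≤ E * K * h := Nat.le_mul_of_pos_right _ hh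
    nlinarith
  have h2 : d * (h + d) + 1 ≤ 3 * (h * d ^ 2) := by
    have a1 : d * h ≤ h * d ^ 2 := by
      rw [mul_comm]
      exact Nat.mul_le_mul_left h (Nat.le_self_pow two_ne_zero d)
    have a2 : d * d ≤ h * d ^ 2 := by
      rw [← sq]
      exact Nat.le_mul_of_pos_left _ hh
    nlinarith
  have h3 : s ≤ 41 * (E * K * h) * (3 * (h * d ^ 2)) * d ^ 2 := by
    rw [hs]
    gcongr
    omega
  have h4 : 1 + h * m ≤ 3 * (h ^ 5 * d ^ 4) := by
    have : 1 ≤ h ^ 5 * d ^ 4 := Nat.succ_le_of_lt (by positivity)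
    rw [hm]
    nlinarith
  have h5 : 20 * (E * K * h) ≤ 20 * (E * K * h) * (h ^ 6 * d ^ 8) :=
    Nat.le_mul_of_pos_right _ (by positivity)
  -- The constant is `389 = 20 + 41 * 3 * 3`.
  calc t + s * (1 + h * m) ≤ 20 * (E * K * h) * (h ^ 6 * d ^ 8) +
        41 * (E * K * h) * (3 * (h * d ^ 2)) * d ^ 2 * (3 * (h ^ 5 * d ^ 4)) :=
        add_le_add (h1.trans h5) (Nat.mul_le_mul h3 h4)
    _ = K * (389 * 450 ^ 8 * h ^ 7 * E ^ 9) := by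
        rw [hd]
        ring

theorem natLog_two_add_one_le {n : ℕ} (hn : 0 < n) :
    ((Nat.log 2 n + 1 : ℕ) : ℝ) ≤ 2 * Real.log n + 1 := by
  have h1 : ((2 : ℝ) ^ Nat.log 2 n) ≤ n := by exact_mod_cast Nat.pow_log_le_self 2 hn.ne'
  have h2 := Real.log_le_log (by positivity) h1
  rw [Real.log_pow] at h2
  have h3 : 1 / 2 ≤ Real.log 2 := by linarith [Real.log_two_gt_d9]
  have h4 : (0 : ℝ) ≤ Nat.log 2 n := Nat.cast_nonneg _
  push_cast
  nlinarith

end AtlasTesting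

end

/-! ### Choice of parameters and conclusion. -/

theorem theorem9 :
    ∃ P : MvPolynomial (Fin 2) ℝ,
      ∀ (k : ℝ → ℕ → ℕ) (C : AtlasTesting.DistProperty),
        AtlasTesting.IsCharacterizedByAtlases k C →
        ∀ (ε : ℝ), 0 < ε → ∀ (n : ℕ),
          ∃ q : ℕ,
            (q : ℝ) ≤ (k (ε / 5) n : ℝ) * MvPolynomial.eval ![Real.log n, 1 / ε] P ∧
            ∃ T : AtlasTesting.CondAlgorithm n Bool q,
              AtlasTesting.IsConditionalTester (C n) ε (1 / 3) T := by
  -- The linear factors dominate `Nat.log 2 n + 1` and `⌈1 / ε⌉₊`, the integers that serve as `h`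
  -- and `E`.
  refine ⟨MvPolynomial.C (389 * 450 ^ 8) * (2 * MvPolynomial.X 0 + 1) ^ 7 *
    (MvPolynomial.X 1 + 1) ^ 9, fun k C hC ε hε n => ?_⟩
  obtain ⟨𝔸, hlen, hcomplete, hsound⟩ := hC n (ε / 5) (by positivity)
  have hlog : 0 ≤ Real.log n := Real.log_natCast_nonneg n
  have heval : MvPolynomial.eval ![Real.log n, 1 / ε] (MvPolynomial.C (389 * 450 ^ 8) *
      (2 * MvPolynomial.X 0 + 1) ^ 7 * (MvPolynomial.X 1 + 1) ^ 9) =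
      389 * 450 ^ 8 * (2 * Real.log n + 1) ^ 7 * (1 / ε + 1) ^ 9 := by
    simp
  rw [heval]
  generalize k (ε / 5) n = K at hlen ⊢
  -- If `n = 0` there are no distributions. If `n > 0` and `K = 0` then `C n` is empty, as an atlas
  -- over a nonempty domain has positive length. Rejecting without a query is then correct.
  rcases Nat.eq_zero_or_pos (K * n) with h0 | h0
  · refine ⟨0, by rw [Nat.cast_zero]; positivity, .done false, fun μ hμ => ?_, fun μ _ => ?_⟩
    · obtain ⟨i, -⟩ := μ.support_nonempty
      obtain ⟨𝒜, h𝒜, -⟩ := hcomplete μ hμ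
      obtain ⟨j, -⟩ := 𝒜.partition.cover i
      have hK : K = 0 := (Nat.mul_eq_zero.1 h0).resolve_right i.pos.ne'
      exact absurd (j.pos.trans_le (hlen 𝒜 h𝒜)) (by omega)
    · simp only [AtlasTesting.CondAlgorithm.run]
      norm_num
  · have hn : 0 < n := Nat.pos_of_mul_pos_left h0
    have hK : 0 < K := Nat.pos_of_mul_pos_right h0
    have hE : 0 < ⌈1 / ε⌉₊ := Nat.ceil_pos.2 (by positivity)
    have hεE : 1 / ε ≤ ⌈1 / ε⌉₊ := Nat.le_ceil _
    have hEle : (⌈1 / ε⌉₊ : ℝ) ≤ 1 / ε + 1 := (Nat.ceil_lt_add_one (by positivity)).le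
    generalize ⌈1 / ε⌉₊ = E at hE hεE hEle
    have hnh : n < 2 ^ (Nat.log 2 n + 1) := Nat.lt_pow_succ_log_self one_lt_two n
    have hh : 0 < Nat.log 2 n + 1 := Nat.succ_pos _
    have hhle := AtlasTesting.natLog_two_add_one_le hn
    generalize Nat.log 2 n + 1 = h at hnh hh hhle
    obtain ⟨d, hd⟩ : ∃ d, d = 450 * E := ⟨_, rfl⟩
    obtain ⟨m, hm⟩ : ∃ m, m = 2 * h ^ 4 * d ^ 4 := ⟨_, rfl⟩
    obtain ⟨t, ht⟩ : ∃ t, t = 10 * E * K * (h + 1) := ⟨_, rfl⟩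
    obtain ⟨s, hs⟩ : ∃ s, s = (2 * t + 1) * (d * (h + d) + 1) * d ^ 2 := ⟨_, rfl⟩
    have hE' : (0 : ℝ) < E := by exact_mod_cast hE
    have hK' : (0 : ℝ) < K := by exact_mod_cast hK
    refine ⟨t + s * (1 + h * m), ?_, AtlasTesting.exists_tester_of_rejection_le
      (AtlasTesting.implementable_sampleLaw t s m h hn)
      (fun μ => {ω | AtlasTesting.Representative (1 / (5 * E * K)) (1 / (5 * E)) s μ ω})
      (AtlasTesting.prob_not_representative_le hh hE hd hnh hm ?_ hs) ?_⟩
    · calc ((t + s * (1 + h * m) : ℕ) : ℝ) ≤ (K * (389 * 450 ^ 8 * h ^ 7 * E ^ 9) : ℕ) := by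
            exact_mod_cast AtlasTesting.query_count_le hh hE hK hd hm ht hs
        _ = K * (389 * 450 ^ 8 * (h : ℝ) ^ 7 * (E : ℝ) ^ 9) := by push_cast; ring
        _ ≤ K * (389 * 450 ^ 8 * (2 * Real.log n + 1) ^ 7 * (1 / ε + 1) ^ 9) := by gcongr
    -- With `τ = 1 / (5 * E * K)` the choice of `t` gives exactly `τ * t = 2 * h + 2`.
    · rw [ht]
      push_cast
      apply le_of_eq
      field_simp
      norm_num
    · intro μ χ hχC ω hμ hχ
      obtain ⟨𝒜, h𝒜, hconf⟩ := hcomplete χ hχC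
      exact AtlasTesting.not_isFar_of_conforming hE hK hεE hε hμ hχ hconf (hlen 𝒜 h𝒜)
        fun χ' => hsound 𝒜 h𝒜 χ'
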